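/- Let $T$ be the unilateral shift $Te_n=e_{n+1}$ on $\ell^2(\mathbb Z_+)$, let $\mathcal T\subset B(\ell^2(\mathbb Z_+))$ be the Toeplitz algebra, i.e. the norm-closed $*$-algebra generated by $T$, put $T_{n,m}=T^nT^{*m}$, and let $\mathcal K\subset\mathcal T$ be the compact operators. Let $\Delta:\mathcal T\to\mathcal T\otimes\mathcal T$ (minimal $C^*$-tensor product) be the unique unital $*$-homomorphism with $\Delta(T)=T\otimes T$, and for $\rho,\varphi$ in the dual space $\mathcal T^*$ put $(\rho\ast\varphi)(A)=(\rho\otimes\varphi)(\Delta(A))$, where $\rho\otimes\varphi$ is the bounded functional on $\mathcal T\otimes\mathcal T$ with $(\rho\otimes\varphi)(A\otimes B)=\rho(A)\varphi(B)$. Then the annihilator $\mathcal K^\perp=\{\rho\in\mathcal T^*:\rho|_{\mathcal K}=0\}$ is a linear subspace of $\mathcal T^*$ closed under $\ast$ (a subalgebra), and the following hold. 1. The map $\pi_1^*:(\mathcal T/\mathcal K)^*\to\mathcal K^\perp$, $\pi_1^*(\varphi)(A)=\varphi([A])$, is an isometric linear bijection. 2. There is an isometric $*$-isomorphism $\pi_2:\mathcal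 T/\mathcal K\to C(S^1)$ with $\pi_2([T_{n,m}])(z)=z^{m-n}$. Let $M(S^1)$ be the space of regular complex Borel measures on the circle with the total variation norm. The map $\mu\mapsto\bigl(x\mapsto\int_{S^1}\pi_2(x)\,d\mu\bigr)$ is an isometric linear bijection $M(S^1)\to(\mathcal T/\mathcal K)^*$. 3. The composed isometric linear bijection $\Phi:M(S^1)\to\mathcal K^\perp$, $\Phi(\mu)(A)=\int_{S^1}\pi_2([A])\,d\mu$, carries convolution of measures (the image of $\mu\times\nu$ under $(z,w)\mapsto zw$) to the product $\ast$: $\Phi(\mu\ast\nu)=\Phi(\mu)\ast\Phi(\nu)$ for all $\mu,\nu\in M(S^1)$. -/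

import Mathlib

noncomputable section

open MeasureTheory UniformSpace
open scoped TensorProduct ENNReal InnerProductSpace

namespace ToeplitzQuantumSemigroup

/-! ### The Toeplitz algebra -/

/-- The Hilbert space `ℓ²(ℤ₊)`. -/
abbrev Ell2 : Type := lp (fun _ : ℕ => ℂ) 2

/-- The unilateral shift `(T f) 0 = 0`, `(T f) (n + 1) = f n`, that is `T eₙ = eₙ₊₁`. -/
def shiftIsometry : Ell2 →ₗᵢ[ℂ] Ell2 where
  toFun f := ⟨fun n => Nat.casesOn n 0 (fun k => f k), by
    apply memℓp_gen
    rw [← summable_nat_add_iff 1]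
    exact (lp.memℓp f).summable (by norm_num)⟩
  map_add' f g := by
    ext n
    cases n with
    | zero => exact (add_zero (0 : ℂ)).symm
    | succ n => rfl
  map_smul' c f := by
    ext n
    cases n <;> simp
  norm_map' f := by
    have h2 : (0 : ℝ) < (2 : ℝ≥0∞).toReal := by norm_num
    rw [lp.norm_eq_tsum_rpow h2, lp.norm_eq_tsum_rpow h2]
    congr 1
    rw [Summable.tsum_eq_zero_add]
    · simp
    · rw [← summable_nat_add_iff 1]
      exact (lp.memℓp f).summable h2

/-- The unilateral shift as a bounded operator. -/
def shift : Ell2 →L[ℂ] Ell2 := shiftIsometry.toContinuousLinearMap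

/-- The operator `T_{n,m} = Tⁿ T*ᵐ`. -/
def monomial (n m : ℕ) : Ell2 →L[ℂ] Ell2 := shift ^ n * (star shift) ^ m

/-- The Toeplitz algebra: the norm closed *-subalgebra of `B(ℓ²(ℤ₊))` generated by the shift. -/
def toeplitz : StarSubalgebra ℂ (Ell2 →L[ℂ] Ell2) := StarAlgebra.elemental ℂ shift

theorem isClosed_toeplitz : IsClosed (toeplitz : Set (Ell2 →L[ℂ] Ell2)) :=
  StarAlgebra.elemental.isClosed ℂ shift

theorem shift_mem : shift ∈ toeplitz := StarAlgebra.elemental.self_mem ℂ shift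

theorem monomial_mem (n m : ℕ) : monomial n m ∈ toeplitz :=
  mul_mem (pow_mem shift_mem n) (pow_mem (star_mem shift_mem) m)

/-! ### Hilbert space tensor products and spatial tensor products of operator algebras -/

section Tensor

variable {H K : Type*} [NormedAddCommGroup H] [InnerProductSpace ℂ H]
  [NormedAddCommGroup K] [InnerProductSpace ℂ K]

/-- The Hilbert space tensor product: the completion of the algebraic tensor product for
`⟪x ⊗ y, x' ⊗ y'⟫ = ⟪x, x'⟫ ⟪y, y'⟫`. -/
def HilbertTensor (H K : Type*) [NormedAddCommGroup H] [InnerProductSpace ℂ H]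
    [NormedAddCommGroup K] [InnerProductSpace ℂ K] : Type _ :=
  Completion (H ⊗[ℂ] K)

instance : NormedAddCommGroup (HilbertTensor H K) :=
  inferInstanceAs (NormedAddCommGroup (Completion (H ⊗[ℂ] K)))

instance : InnerProductSpace ℂ (HilbertTensor H K) :=
  inferInstanceAs (InnerProductSpace ℂ (Completion (H ⊗[ℂ] K)))

instance : CompleteSpace (HilbertTensor H K) :=
  inferInstanceAs (CompleteSpace (Completion (H ⊗[ℂ] K)))

/-- The isometric embedding of the algebraic tensor product. -/
def embed : (H ⊗[ℂ] K) →ₗᵢ[ℂ] HilbertTensor H K :=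
  (Completion.toComplₗᵢ : (H ⊗[ℂ] K) →ₗᵢ[ℂ] Completion (H ⊗[ℂ] K))

theorem denseRange_embed : DenseRange (embed : (H ⊗[ℂ] K) → HilbertTensor H K) :=
  Completion.denseRange_coe

/-- The elementary tensor `x ⊗ y` in the Hilbert space tensor product. -/
def tmul (x : H) (y : K) : HilbertTensor H K := embed (x ⊗ₜ[ℂ] y)

/-- The bounded operator `a ⊗ b`, determined by `(a ⊗ b) (x ⊗ y) = a x ⊗ b y`. -/
def tensorOp (a : H →L[ℂ] H) (b : K →L[ℂ] K) : HilbertTensor H K →L[ℂ] HilbertTensor H K :=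
  (TensorProduct.mapL a b).completion

theorem tensorOp_tmul (a : H →L[ℂ] H) (b : K →L[ℂ] K) (x : H) (y : K) :
    tensorOp a b (tmul x y) = tmul (a x) (b y) :=
  (TensorProduct.mapL a b).completion_apply_coe (x ⊗ₜ[ℂ] y)

theorem inner_tmul_tmul (x x' : H) (y y' : K) :
    inner ℂ (tmul x y) (tmul x' y') = inner ℂ x x' * inner ℂ y y' := by
  rw [tmul, tmul, LinearIsometry.inner_map_map, TensorProduct.inner_tmul]

theorem op_ext {F : Type*} [NormedAddCommGroup F] [NormedSpace ℂ F]
    {f g : HilbertTensor H K →L[ℂ] F} (h : ∀ x y, f (tmul x y) = g (tmul x y)) : f = g := by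
  ext z
  induction z using denseRange_embed.induction_on with
  | hp => exact isClosed_eq f.continuous g.continuous
  | ih z =>
    induction z with
    | zero => simp
    | tmul x y => exact h x y
    | add z w hz hw => simp only [map_add, hz, hw]

theorem tensorOp_one : tensorOp (1 : H →L[ℂ] H) (1 : K →L[ℂ] K) = 1 :=
  op_ext fun x y => by simp [tensorOp_tmul]

theorem tensorOp_mul (a a' : H →L[ℂ] H) (b b' : K →L[ℂ] K) :
    tensorOp (a * a') (b * b') = tensorOp a b * tensorOp a' b' :=
  op_ext fun x y => by simp [tensorOp_tmul]

theorem tmul_add_left (x x' : H) (y : K) : tmul (x + x') y = tmul x y + tmul x' y := by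
  simp [tmul, TensorProduct.add_tmul]

theorem tmul_smul_left (c : ℂ) (x : H) (y : K) : tmul (c • x) y = c • tmul x y := by
  simp [tmul, ← TensorProduct.smul_tmul']

theorem tmul_add_right (x : H) (y y' : K) : tmul x (y + y') = tmul x y + tmul x y' := by
  simp [tmul, TensorProduct.tmul_add]

theorem tmul_smul_right (c : ℂ) (x : H) (y : K) : tmul x (c • y) = c • tmul x y := by
  simp [tmul]

theorem tensorOp_star [CompleteSpace H] [CompleteSpace K] (a : H →L[ℂ] H) (b : K →L[ℂ] K) :
    star (tensorOp a b) = tensorOp (star a) (star b) := by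
  symm
  simp only [ContinuousLinearMap.star_eq_adjoint]
  rw [ContinuousLinearMap.eq_adjoint_iff]
  intro z w
  induction z using denseRange_embed.induction_on with
  | hp => exact isClosed_eq (by fun_prop) (by fun_prop)
  | ih z =>
    induction w using denseRange_embed.induction_on with
    | hp => exact isClosed_eq (by fun_prop) (by fun_prop)
    | ih w =>
      induction z with
      | zero => simp
      | add z z' hz hz' => simp only [map_add, inner_add_left, hz, hz']
      | tmul x y =>
        induction w with
        | zero => simp
        | add w w' hz hz' => simp only [map_add, inner_add_right, hz, hz']
        | tmul x' y' =>
          change inner ℂ (tensorOp _ _ (tmul x y)) (tmul x' y')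
            = inner ℂ (tmul x y) (tensorOp _ _ (tmul x' y'))
          simp only [tensorOp_tmul, inner_tmul_tmul, ContinuousLinearMap.adjoint_inner_left]

/-- `x ↦ x ⊗ y` as a bounded operator. -/
def tmulRight (y : K) : H →L[ℂ] HilbertTensor H K :=
  LinearMap.mkContinuous
    { toFun := fun x => tmul x y
      map_add' := fun x x' => tmul_add_left x x' y
      map_smul' := fun c x => tmul_smul_left c x y } ‖y‖ (fun x => by
        simp [tmul, mul_comm])

theorem norm_tmulRight_le (y : K) : ‖(tmulRight y : H →L[ℂ] HilbertTensor H K)‖ ≤ ‖y‖ :=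
  LinearMap.mkContinuous_norm_le _ (norm_nonneg _) _

theorem tmulRight_add (y y' : K) :
    (tmulRight (y + y') : H →L[ℂ] HilbertTensor H K) = tmulRight y + tmulRight y' := by
  ext x
  exact tmul_add_right x y y'

theorem tmulRight_smul (c : ℂ) (y : K) :
    (tmulRight (c • y) : H →L[ℂ] HilbertTensor H K) = c • tmulRight y := by
  ext x
  exact tmul_smul_right c x y

/-- The minimal (spatial) C*-tensor product of two operator algebras: the norm closed *-subalgebra
of `B(H ⊗ K)` generated by the elementary tensors. -/
def spatialTensor [CompleteSpace H] [CompleteSpace K] (A : StarSubalgebra ℂ (H →L[ℂ] H))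
    (B : StarSubalgebra ℂ (K →L[ℂ] K)) :
    StarSubalgebra ℂ (HilbertTensor H K →L[ℂ] HilbertTensor H K) :=
  (StarAlgebra.adjoin ℂ {x | ∃ a ∈ A, ∃ b ∈ B, x = tensorOp a b}).topologicalClosure

variable [CompleteSpace H] [CompleteSpace K] {A : StarSubalgebra ℂ (H →L[ℂ] H)}
  {B : StarSubalgebra ℂ (K →L[ℂ] K)}

theorem tensorOp_mem {a : H →L[ℂ] H} {b : K →L[ℂ] K} (ha : a ∈ A) (hb : b ∈ B) :
    tensorOp a b ∈ spatialTensor A B :=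
  StarSubalgebra.le_topologicalClosure _ (StarAlgebra.subset_adjoin ℂ _ ⟨a, ha, b, hb, rfl⟩)

/-- The elementary tensor `a ⊗ b` as an element of the spatial tensor product. -/
def elemTensor (a : A) (b : B) : spatialTensor A B :=
  ⟨tensorOp (a : H →L[ℂ] H) (b : K →L[ℂ] K), tensorOp_mem a.2 b.2⟩

/-- Elementary tensors span a dense subspace of the spatial tensor product. -/
theorem spatialTensor_eq_closure :
    (spatialTensor A B : Set (HilbertTensor H K →L[ℂ] HilbertTensor H K)) =
      closure (Submodule.span ℂ {x | ∃ a ∈ A, ∃ b ∈ B, x = tensorOp a b} :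
        Set (HilbertTensor H K →L[ℂ] HilbertTensor H K)) := by
  rw [spatialTensor, StarSubalgebra.topologicalClosure_coe]
  congr 1
  have key : ((Submonoid.closure ({x | ∃ a ∈ A, ∃ b ∈ B, x = tensorOp a b} ∪
      star {x | ∃ a ∈ A, ∃ b ∈ B, x = tensorOp a b}) : Submonoid _) :
        Set (HilbertTensor H K →L[ℂ] HilbertTensor H K)) =
      {x | ∃ a ∈ A, ∃ b ∈ B, x = tensorOp a b} := by
    apply Set.Subset.antisymm
    · intro x hx
      induction hx using Submonoid.closure_induction with
      | mem x hx =>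
        rcases hx with hx | hx
        · exact hx
        · obtain ⟨a, ha, b, hb, h⟩ := hx
          exact ⟨star a, star_mem ha, star b, star_mem hb, by
            rw [← tensorOp_star, ← h, star_star]⟩
      | one => exact ⟨1, one_mem A, 1, one_mem B, tensorOp_one.symm⟩
      | mul x y _ _ hx hy =>
        obtain ⟨a, ha, b, hb, rfl⟩ := hx
        obtain ⟨a', ha', b', hb', rfl⟩ := hy
        exact ⟨a * a', mul_mem ha ha', b * b', mul_mem hb hb', (tensorOp_mul _ _ _ _).symm⟩
    · exact fun x hx => Submonoid.subset_closure (Or.inl hx)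
  have := StarAlgebra.adjoin_eq_span (R := ℂ)
    {x : HilbertTensor H K →L[ℂ] HilbertTensor H K | ∃ a ∈ A, ∃ b ∈ B, x = tensorOp a b}
  rw [key] at this
  exact congrArg (fun S : Submodule ℂ (HilbertTensor H K →L[ℂ] HilbertTensor H K) =>
    (S : Set (HilbertTensor H K →L[ℂ] HilbertTensor H K))) this

/-- The compression of an operator on `H ⊗ K` to `H` by two vectors of `K`. -/
def compress (x : HilbertTensor H K →L[ℂ] HilbertTensor H K) (y y' : K) : H →L[ℂ] H :=
  (ContinuousLinearMap.adjoint (tmulRight y)) ∘L x ∘L (tmulRight y')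

theorem norm_compress_le (x : HilbertTensor H K →L[ℂ] HilbertTensor H K) (y y' : K) :
    ‖compress x y y'‖ ≤ ‖x‖ * ‖y‖ * ‖y'‖ := by
  have h1 := norm_tmulRight_le (H := H) y
  have h2 := norm_tmulRight_le (H := H) y'
  calc ‖compress x y y'‖ ≤ ‖ContinuousLinearMap.adjoint (tmulRight (H := H) y)‖ *
        (‖x‖ * ‖tmulRight (H := H) y'‖) :=
        (ContinuousLinearMap.opNorm_comp_le _ _).trans
          (mul_le_mul_of_nonneg_left (ContinuousLinearMap.opNorm_comp_le _ _) (norm_nonneg _))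
    _ ≤ ‖y‖ * (‖x‖ * ‖y'‖) := by
        rw [LinearIsometryEquiv.norm_map]
        gcongr
    _ = ‖x‖ * ‖y‖ * ‖y'‖ := by ring

theorem compress_tensorOp (a : H →L[ℂ] H) (b : K →L[ℂ] K) (y y' : K) :
    compress (tensorOp a b) y y' = (inner ℂ y (b y')) • a := by
  ext x
  apply ext_inner_left ℂ
  intro v
  change inner ℂ v (ContinuousLinearMap.adjoint (tmulRight y) (tensorOp a b (tmul x y'))) = _
  rw [ContinuousLinearMap.adjoint_inner_right, tensorOp_tmul]
  change inner ℂ (tmul v y) _ = _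
  rw [inner_tmul_tmul]
  simp [inner_smul_right, mul_comm]

/-- The slice map `ρ ⊗ id : B(H ⊗ K) → B(K)`, `⟪y, (ρ ⊗ id)(x) y'⟫ = ρ (V_y* x V_y')`. -/
theorem exists_slice (ρ : StrongDual ℂ (H →L[ℂ] H)) :
    ∃ R : (HilbertTensor H K →L[ℂ] HilbertTensor H K) →L[ℂ] (K →L[ℂ] K),
      ∀ a b, R (tensorOp a b) = ρ a • b := by
  let form (x : HilbertTensor H K →L[ℂ] HilbertTensor H K) : K →L⋆[ℂ] K →L[ℂ] ℂ :=
    LinearMap.mkContinuous₂ (LinearMap.mk₂'ₛₗ (starRingEnd ℂ) (RingHom.id ℂ)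
      (fun y y' => ρ (compress x y y'))
      (fun y z y' => by simp [compress, tmulRight_add, ContinuousLinearMap.add_comp])
      (fun c y y' => by
        simp [compress, tmulRight_smul, ContinuousLinearMap.smul_comp, LinearIsometryEquiv.map_smulₛₗ])
      (fun y z y' => by simp [compress, tmulRight_add, ContinuousLinearMap.comp_add])
      (fun c y y' => by simp [compress, tmulRight_smul]))
      (‖ρ‖ * ‖x‖) (fun y y' => by
        refine (ρ.le_opNorm _).trans ?_
        have := mul_le_mul_of_nonneg_left (norm_compress_le x y y') (norm_nonneg ρ)
        calc _ ≤ _ := this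
          _ = _ := by ring)
  have hform (x y y') : form x y y' = ρ (compress x y y') := rfl
  let S (x : HilbertTensor H K →L[ℂ] HilbertTensor H K) : K →L[ℂ] K :=
    ContinuousLinearMap.adjoint (InnerProductSpace.continuousLinearMapOfBilin (form x))
  have hS (x y y') : inner ℂ y (S x y') = ρ (compress x y y') := by
    simp [S, ContinuousLinearMap.adjoint_inner_right, hform]
  refine ⟨LinearMap.mkContinuous
    { toFun := S
      map_add' := fun x x' => ?_
      map_smul' := fun c x => ?_ } ‖ρ‖ (fun x => ?_), fun a b => ?_⟩
  · ext y'
    refine ext_inner_left ℂ fun y => ?_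
    simp [hS, inner_add_right, compress, ContinuousLinearMap.add_comp,
      ContinuousLinearMap.comp_add]
  · ext y'
    refine ext_inner_left ℂ fun y => ?_
    simp [hS, inner_smul_right, compress, ContinuousLinearMap.smul_comp]
  · change ‖S x‖ ≤ _
    refine ContinuousLinearMap.opNorm_le_bound _ (by positivity) fun y' => ?_
    have h1 : ‖S x y'‖ * ‖S x y'‖ ≤ (‖ρ‖ * ‖x‖ * ‖y'‖) * ‖S x y'‖ := by
      have h2 : ‖(inner ℂ (S x y') (S x y') : ℂ)‖ = ‖S x y'‖ * ‖S x y'‖ := by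
        rw [inner_self_eq_norm_sq_to_K]
        simp [pow_two]
      rw [← h2, hS]
      refine (ρ.le_opNorm _).trans ?_
      refine (mul_le_mul_of_nonneg_left (norm_compress_le x _ y') (norm_nonneg ρ)).trans ?_
      exact le_of_eq (by ring)
    by_cases h0 : ‖S x y'‖ = 0
    · rw [h0]
      positivity
    · exact le_of_mul_le_mul_right h1 (lt_of_le_of_ne (norm_nonneg _) (Ne.symm h0))
  · change S (tensorOp a b) = _
    ext y'
    refine ext_inner_left ℂ fun y => ?_
    simp [hS, compress_tensorOp, inner_smul_right, mul_comm]

/-- For bounded functionals `ρ` on `A` and `φ` on `B` there is exactly one bounded functional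
`ρ ⊗ φ` on the spatial tensor product with `(ρ ⊗ φ)(a ⊗ b) = ρ(a) φ(b)`. -/
theorem existsUnique_tensorFunctional (ρ : StrongDual ℂ A) (φ : StrongDual ℂ B) :
    ∃! Θ : StrongDual ℂ (spatialTensor A B), ∀ a b, Θ (elemTensor a b) = ρ a * φ b := by
  obtain ⟨ρ', hρ', -⟩ := exists_extension_norm_eq (𝕜 := ℂ) (Subalgebra.toSubmodule A.toSubalgebra) ρ
  obtain ⟨φ', hφ', -⟩ := exists_extension_norm_eq (𝕜 := ℂ) (Subalgebra.toSubmodule B.toSubalgebra) φ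
  obtain ⟨R, hR⟩ := exists_slice (K := K) ρ'
  refine ⟨(φ' ∘L R) ∘L (Subalgebra.toSubmodule (spatialTensor A B).toSubalgebra).subtypeL, ?_, ?_⟩
  · intro a b
    change φ' (R (tensorOp _ _)) = _
    rw [hR, map_smul, smul_eq_mul]
    congr 1
    · exact hρ' a
    · exact hφ' b
  · intro Θ hΘ
    obtain ⟨Θ', hΘ', -⟩ := exists_extension_norm_eq (𝕜 := ℂ)
      (Subalgebra.toSubmodule (spatialTensor A B).toSubalgebra) Θ
    have hc : Set.EqOn Θ' (φ' ∘L R)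
        (spatialTensor A B : Set (HilbertTensor H K →L[ℂ] HilbertTensor H K)) := by
      rw [spatialTensor_eq_closure]
      refine Set.EqOn.closure ?_ Θ'.continuous (φ' ∘L R).continuous
      refine LinearMap.eqOn_span (f := Θ'.toLinearMap) (g := (φ' ∘L R).toLinearMap) ?_
      rintro _ ⟨a, ha, b, hb, rfl⟩
      change Θ' (tensorOp a b) = φ' (R (tensorOp a b))
      rw [hR, map_smul, smul_eq_mul]
      have h1 := hΘ' (elemTensor ⟨a, ha⟩ ⟨b, hb⟩)
      have h2 := hΘ ⟨a, ha⟩ ⟨b, hb⟩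
      rw [← hρ' ⟨a, ha⟩, ← hφ' ⟨b, hb⟩] at h2
      exact h1.trans h2
    ext x
    rw [← hΘ' x]
    exact hc x.2

/-- The functional `ρ ⊗ φ` on the spatial tensor product. -/
def tensorFunctional (ρ : StrongDual ℂ A) (φ : StrongDual ℂ B) :
    StrongDual ℂ (spatialTensor A B) :=
  (existsUnique_tensorFunctional ρ φ).choose

theorem tensorFunctional_apply (ρ : StrongDual ℂ A) (φ : StrongDual ℂ B) (a : A) (b : B) :
    tensorFunctional ρ φ (elemTensor a b) = ρ a * φ b :=
  (existsUnique_tensorFunctional ρ φ).choose_spec.1 a b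


theorem hilbertBasis_ext {ι F : Type*} [NormedAddCommGroup F] [NormedSpace ℂ F]
    (b : HilbertBasis ι ℂ H) {f g : H →L[ℂ] F} (h : ∀ i, f (b i) = g (b i)) : f = g := by
  refine ContinuousLinearMap.ext_on (s := Set.range b) ?_ ?_
  · have := b.dense_span
    rwa [Submodule.dense_iff_topologicalClosure_eq_top]
  · rintro _ ⟨i, rfl⟩
    exact h i

/-- The Hilbert basis of a Hilbert space tensor product given by two Hilbert bases. -/
theorem exists_tensorBasis {ι κ σ : Type*} (b : HilbertBasis ι ℂ H) (c : HilbertBasis κ ℂ K)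
    (e : σ ≃ ι × κ) :
    ∃ d : HilbertBasis σ ℂ (HilbertTensor H K), ∀ s, d s = tmul (b (e s).1) (c (e s).2) := by
  have ho : Orthonormal ℂ fun s => tmul (b (e s).1) (c (e s).2) := by
    have := (b.orthonormal.tmul c.orthonormal).comp e e.injective
    exact this.comp_linearIsometry embed
  have hd : (Submodule.span ℂ (Set.range fun s => tmul (b (e s).1) (c (e s).2)))ᗮ = ⊥ := by
    rw [Submodule.eq_bot_iff]
    intro z hz
    have h0 : ∀ i j, inner ℂ z (tmul (b i) (c j)) = 0 := fun i j => by
      have hm : tmul (b i) (c j) ∈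
          Submodule.span ℂ (Set.range fun s => tmul (b (e s).1) (c (e s).2)) :=
        Submodule.subset_span ⟨e.symm (i, j), by simp⟩
      exact Submodule.inner_left_of_mem_orthogonal hm hz
    have h1 : ∀ j x, inner ℂ z (tmul x (c j)) = 0 := fun j x => by
      have : (innerSL ℂ z) ∘L (tmulRight (c j)) = 0 :=
        hilbertBasis_ext b fun i => h0 i j
      exact DFunLike.congr_fun this x
    have h2 : ∀ x y, inner ℂ z (tmul x y) = 0 := fun x y => by
      let f : K →L[ℂ] HilbertTensor H K := embed.toContinuousLinearMap ∘L TensorProduct.mkL ℂ H K x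
      have : (innerSL ℂ z) ∘L f = 0 := hilbertBasis_ext c fun j => h1 j x
      exact DFunLike.congr_fun this y
    have h3 : innerSL ℂ z = 0 := op_ext fun x y => h2 x y
    exact inner_self_eq_zero.1 (DFunLike.congr_fun h3 z)
  exact ⟨HilbertBasis.mkOfOrthogonalEqBot ho hd, fun s => by
    rw [HilbertBasis.coe_mkOfOrthogonalEqBot]⟩

/-- The amplification `a ↦ a ⊗ 1`. -/
def amplify (K : Type*) [NormedAddCommGroup K] [InnerProductSpace ℂ K] [CompleteSpace K] :
    (H →L[ℂ] H) →⋆ₐ[ℂ] (HilbertTensor H K →L[ℂ] HilbertTensor H K) where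
  toFun a := tensorOp a 1
  map_one' := tensorOp_one
  map_mul' a a' := by rw [← tensorOp_mul, one_mul]
  map_zero' := op_ext fun x y => by
    rw [tensorOp_tmul]
    simpa using tmul_smul_left (0 : ℂ) (0 : H) y
  map_add' a a' := op_ext fun x y => by simp [tensorOp_tmul, tmul_add_left]
  commutes' r := op_ext fun x y => by
    simp [tensorOp_tmul, Algebra.algebraMap_eq_smul_one, tmul_smul_left]
  map_star' a := by rw [tensorOp_star, star_one]

end Tensor

/-! ### The comultiplication and the product of the dual space -/

/-- The index bijection `(n, d) ↦ (n + d⁺, n + d⁻)`. -/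
def indexEquiv : ℕ × ℤ ≃ ℕ × ℕ where
  toFun p := (p.1 + p.2.toNat, p.1 + (-p.2).toNat)
  invFun q := (min q.1 q.2, (q.1 : ℤ) - q.2)
  left_inv p := by ext <;> simp; omega
  right_inv q := by ext <;> simp <;> omega

/-- The standard basis vectors of `ℓ²`, as a Hilbert basis. -/
def stdBasis (ι : Type*) : HilbertBasis ι ℂ (lp (fun _ : ι => ℂ) 2) :=
  ⟨LinearIsometryEquiv.refl ℂ _⟩

theorem shift_stdBasis (n : ℕ) : shift (stdBasis ℕ n) = stdBasis ℕ (n + 1) := by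
  classical
  ext k
  rw [← HilbertBasis.repr_symm_single, ← HilbertBasis.repr_symm_single]
  change (Nat.casesOn k 0 (fun k => (lp.single 2 n (1 : ℂ) : Ell2) k) : ℂ) =
    (lp.single 2 (n + 1) (1 : ℂ) : Ell2) k
  cases k with
  | zero => simp [lp.single_apply]
  | succ k => simp [lp.single_apply, Pi.single_apply]

/-- The C*-algebra `𝒯 ⊗ 𝒯`. -/
abbrev toeplitz₂ : StarSubalgebra ℂ (HilbertTensor Ell2 Ell2 →L[ℂ] HilbertTensor Ell2 Ell2) :=
  spatialTensor toeplitz toeplitz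

/-- The shift as an element of the Toeplitz algebra. -/
def T : toeplitz := ⟨shift, shift_mem⟩

/-- The operator `T_{n,m}` as an element of the Toeplitz algebra. -/
def Tmon (n m : ℕ) : toeplitz := ⟨monomial n m, monomial_mem n m⟩

/-- There is exactly one unital *-homomorphism `Δ : 𝒯 → 𝒯 ⊗ 𝒯` with `Δ(T) = T ⊗ T`. -/
theorem existsUnique_comul :
    ∃! Δ : toeplitz →⋆ₐ[ℂ] toeplitz₂, Δ T = elemTensor T T := by
  obtain ⟨b₁, hb₁⟩ := exists_tensorBasis (stdBasis ℕ) (stdBasis ℤ) (Equiv.refl _)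
  obtain ⟨b₂, hb₂⟩ := exists_tensorBasis (stdBasis ℕ) (stdBasis ℕ) indexEquiv
  let U := b₁.repr.trans b₂.repr.symm
  have hU (i) : U (b₁ i) = b₂ i := by
    classical
    simp [U, HilbertBasis.repr_self]
  have hU' (i) : U.symm (b₂ i) = b₁ i := by rw [← hU, LinearIsometryEquiv.symm_apply_apply]
  let Ψ : (Ell2 →L[ℂ] Ell2) →⋆ₐ[ℂ] (HilbertTensor Ell2 Ell2 →L[ℂ] HilbertTensor Ell2 Ell2) :=
    (U.conjStarAlgEquiv.toStarAlgHom).comp (amplify (lp (fun _ : ℤ => ℂ) 2))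
  have hΨc : Continuous Ψ := map_continuous Ψ
  have hΨ : Ψ shift = tensorOp shift shift := by
    refine hilbertBasis_ext b₂ fun i => ?_
    change U (tensorOp shift 1 (U.symm (b₂ i))) = _
    obtain ⟨n, d⟩ := i
    have h1 : b₁ (n + 1, d) = tensorOp shift 1 (b₁ (n, d)) := by
      simp [hb₁, tensorOp_tmul, shift_stdBasis]
    rw [hU', ← h1, hU, hb₂, hb₂, tensorOp_tmul, shift_stdBasis, shift_stdBasis]
    simp only [indexEquiv, Equiv.coe_fn_mk]
    congr 2 <;> omega
  have hmem : toeplitz ≤ toeplitz₂.comap Ψ := by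
    refine (StarAlgebra.elemental.le_iff_mem ?_).2 ?_
    · exact (StarSubalgebra.isClosed_topologicalClosure _).preimage hΨc
    · change Ψ shift ∈ toeplitz₂
      rw [hΨ]
      exact tensorOp_mem shift_mem shift_mem
  have hcont (Δ : toeplitz →⋆ₐ[ℂ] toeplitz₂) : Continuous Δ := by
    have : IsClosed (toeplitz : Set (Ell2 →L[ℂ] Ell2)) := isClosed_toeplitz
    have : IsClosed (toeplitz₂ : Set (HilbertTensor Ell2 Ell2 →L[ℂ] HilbertTensor Ell2 Ell2)) :=
      StarSubalgebra.isClosed_topologicalClosure _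
    exact AddMonoidHomClass.continuous_of_bound Δ 1 fun x => by
      simpa using NonUnitalStarAlgHom.norm_apply_le Δ x
  have h₀ : (Ψ.comp toeplitz.subtype).codRestrict toeplitz₂ (fun x => hmem x.2) T =
      elemTensor T T := Subtype.ext hΨ
  exact ⟨_, h₀, fun Δ hΔ => StarAlgebra.elemental.starAlgHomClass_ext ℂ (hcont Δ) (hcont _)
    (hΔ.trans h₀.symm)⟩

/-- The comultiplication of the Toeplitz algebra. -/
def comul : toeplitz →⋆ₐ[ℂ] toeplitz₂ := existsUnique_comul.choose

theorem comul_T : comul T = elemTensor T T := existsUnique_comul.choose_spec.1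

/-- The product `ρ ∗ φ = (ρ ⊗ φ) ∘ Δ` of the dual space `𝒯*`. -/
def dualMul (ρ φ : StrongDual ℂ toeplitz) : StrongDual ℂ toeplitz :=
  LinearMap.mkContinuousOfExistsBound
    ((tensorFunctional ρ φ).toLinearMap ∘ₗ comul.toAlgHom.toLinearMap) <| by
      have : IsClosed (toeplitz : Set (Ell2 →L[ℂ] Ell2)) := isClosed_toeplitz
      have : IsClosed (toeplitz₂ : Set (HilbertTensor Ell2 Ell2 →L[ℂ] HilbertTensor Ell2 Ell2)) :=
        StarSubalgebra.isClosed_topologicalClosure _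
      refine ⟨‖tensorFunctional ρ φ‖, fun A => ((tensorFunctional ρ φ).le_opNorm _).trans ?_⟩
      exact mul_le_mul_of_nonneg_left (NonUnitalStarAlgHom.norm_apply_le comul A) (norm_nonneg _)

theorem dualMul_apply (ρ φ : StrongDual ℂ toeplitz) (A : toeplitz) :
    dualMul ρ φ A = tensorFunctional ρ φ (comul A) := rfl

/-- The compact operators in the Toeplitz algebra (which contains all compact operators), as a
subspace of `𝒯`. -/
def compacts : Submodule ℂ toeplitz where
  carrier := {A | IsCompactOperator (A : Ell2 →L[ℂ] Ell2)}
  add_mem' hA hB := hA.add hB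
  zero_mem' := isCompactOperator_zero
  smul_mem' c _ hA := hA.smul c

/-- The annihilator `𝒦^⊥` of the compact operators in `𝒯*`. -/
def annihilator : Submodule ℂ (StrongDual ℂ toeplitz) where
  carrier := {ρ | ∀ A ∈ compacts, ρ A = 0}
  add_mem' hρ hφ A hA := by simp [hρ A hA, hφ A hA]
  zero_mem' _ _ := rfl
  smul_mem' c _ hρ A hA := by simp [hρ A hA]

/-! ### Complex Borel measures on the circle -/

instance : MeasurableSpace Circle := borel Circle

instance : BorelSpace Circle := ⟨rfl⟩

/-- A complex measure has finite total variation. -/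
instance {X : Type*} [MeasurableSpace X] (μ : ComplexMeasure X) : IsFiniteMeasure μ.variation := by
  refine isFiniteMeasure_of_le
    ((ComplexMeasure.re μ).totalVariation + (ComplexMeasure.im μ).totalVariation) ?_
  refine VectorMeasure.variation_le_of_forall_enorm_le fun s hs => ?_
  have h1 := SignedMeasure.enorm_le_totalVariation (ComplexMeasure.re μ) s
  have h2 := SignedMeasure.enorm_le_totalVariation (ComplexMeasure.im μ) s
  have h3 : ‖μ s‖ₑ ≤ ‖(μ s).re‖ₑ + ‖(μ s).im‖ₑ := by
    have h := Complex.norm_le_abs_re_add_abs_im (μ s)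
    rw [← Real.norm_eq_abs, ← Real.norm_eq_abs] at h
    simpa [← ofReal_norm, ENNReal.ofReal_add] using ENNReal.ofReal_le_ofReal h
  exact h3.trans (add_le_add h1 h2)

/-- Every complex Borel measure on the circle is regular, so that `M(S¹)` is
`ComplexMeasure Circle`. -/
theorem regular_variation (μ : ComplexMeasure Circle) : μ.variation.Regular := inferInstance

/-- The norm of `M(S¹)`: the total variation. -/
def totalVariationNorm (μ : ComplexMeasure Circle) : ℝ := (μ.variation Set.univ).toReal

/-- The integral of a complex function against a complex measure on the circle. -/
def cintegral (μ : ComplexMeasure Circle) (f : Circle → ℂ) : ℂ :=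
  μ.integral f (ContinuousLinearMap.mul ℝ ℂ)

/-- The convolution of two complex measures on the circle: the image of the product measure under
the multiplication of the circle. -/
def mconv (μ ν : ComplexMeasure Circle) : ComplexMeasure Circle :=
  (μ.prod ν (ContinuousLinearMap.mul ℝ ℂ)).map fun p => p.1 * p.2

end ToeplitzQuantumSemigroup

end

open MeasureTheory ToeplitzQuantumSemigroup

/-!
A bounded functional on `C(S¹)` is the integral against a complex measure: its variation is given by
a positive measure `λ`, so that it extends to `L¹(λ)`, and the values of the extension on indicator
functions form the complex measure. Hence everything rests on the identification of `𝒯 / 𝒦` with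
`C(S¹)`.

A function `f` on the circle has a Toeplitz operator, the compression to `ℓ²(ℤ₊)` of `f` of the
backward bilateral shift; hence `f ↦ [T_f]` is contractive. It sends `z ^ (m - n)` to the class of
`T_{n,m}`, and the `T_{n,m}` span a dense subspace, so it is onto once it is isometric. For this let
`k_w` be the normalised geometric sequences `(w ^ n)`, `|w| < 1`: when `w` tends to a point `z` of
the circle they tend weakly to `0`, so that `⟨k_w, K k_w⟩ → 0` for compact `K`, whereas
`⟨k_w, T_f k_w⟩ → f z`. Thus `|f z| ≤ ‖T_f + K‖`.

Finally `Δ(T_{n,m}) = T_{n,m} ⊗ T_{n,m}`, so on each `T_{n,m}` the product `∗` multiplies values,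
just as convolution multiplies the integrals of a character.
-/

noncomputable section

open ContinuousLinearMap (mul)
open Filter Topology
open scoped ENNReal NNReal CompactlySupported InnerProductSpace

namespace ToeplitzQuantumSemigroup

section ComplexIntegral

variable {X Y : Type*} [MeasurableSpace X] [MeasurableSpace Y]

theorem integral_const_mul_complexMeasure (μ : ComplexMeasure X) (c : ℂ) (f : X → ℂ) :
    ∫ᵛ x, c * f x ∂[mul ℝ ℂ; μ] = c * ∫ᵛ x, f x ∂[mul ℝ ℂ; μ] :=
  setToFun_smul (𝕜 := ℂ) _ (fun c s x => by
    change c • x * μ s = c • (x * μ s)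
    rw [smul_mul_assoc]) c f

theorem norm_integral_complexMeasure_le (μ : ComplexMeasure X) (f : X → ℂ) :
    ‖∫ᵛ x, f x ∂[mul ℝ ℂ; μ]‖ ≤ ∫ x, ‖f x‖ ∂μ.variation := by
  simpa using μ.norm_integral_le_integral_norm (B := mul ℝ ℂ) (f := f)

theorem L1_functional_ext {lam : Measure X} [IsFiniteMeasure lam] {F G : StrongDual ℂ (X →₁[lam] ℂ)}
    (h : ∀ s (hs : MeasurableSet s), F (indicatorConstLp 1 hs (measure_ne_top lam s) 1) =
      G (indicatorConstLp 1 hs (measure_ne_top lam s) 1)) : F = G := by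
  ext f
  induction f using Lp.induction (by simp : (1 : ℝ≥0∞) ≠ ∞) with
  | @indicatorConst c s hs hμs =>
    have hc : indicatorConstLp 1 hs hμs.ne c = c • indicatorConstLp 1 hs hμs.ne (1 : ℂ) := by
      simp only [indicatorConstLp, ← MemLp.toLp_const_smul]
      congr with x
      by_cases hx : x ∈ s <;> simp [hx]
    rw [Lp.simpleFunc.coe_indicatorConst, hc, map_smul, map_smul, h _ hs]
  | add hf hg _ hFf hFg => rw [map_add, map_add, hFf, hFg]
  | isClosed => exact isClosed_eq F.continuous G.continuous

/-- Integration against `μ` as a functional on `L¹(lam)`, for a positive measure `lam` dominating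
`μ` up to the factor `c`. -/
def integralL1 (μ : ComplexMeasure X) {lam : Measure X} {c : ℝ≥0} (h : μ.variation ≤ c • lam) :
    StrongDual ℂ (X →₁[lam] ℂ) :=
  have hac : μ.variation ≪ lam := Measure.absolutelyContinuous_of_le_smul h
  have hint (f : X →₁[lam] ℂ) : μ.Integrable f :=
    ((L1.integrable_coeFn f).smul_measure_nnreal (c := c)).mono_measure h
  LinearMap.mkContinuous
    { toFun f := ∫ᵛ x, f x ∂[mul ℝ ℂ; μ]
      map_add' f g := by
        rw [VectorMeasure.integral_congr_ae (hac.ae_eq (Lp.coeFn_add f g)),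
          VectorMeasure.integral_add (hint f) (hint g)]
      map_smul' a f := by
        rw [VectorMeasure.integral_congr_ae (hac.ae_eq (Lp.coeFn_smul a f))]
        exact integral_const_mul_complexMeasure μ a f }
    c fun f => by
      calc ‖∫ᵛ x, f x ∂[mul ℝ ℂ; μ]‖ ≤ ∫ x, ‖f x‖ ∂μ.variation :=
            norm_integral_complexMeasure_le μ f
        _ ≤ ∫ x, ‖f x‖ ∂(c • lam) :=
            integral_mono_measure h (Eventually.of_forall fun _ => norm_nonneg _)
              ((L1.integrable_coeFn f).norm.smul_measure_nnreal)
        _ = c * ‖f‖ := by rw [integral_smul_nnreal_measure, L1.norm_eq_integral_norm]; rfl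

theorem integralL1_apply (μ : ComplexMeasure X) {lam : Measure X} {c : ℝ≥0}
    (h : μ.variation ≤ c • lam) (f : X →₁[lam] ℂ) :
    integralL1 μ h f = ∫ᵛ x, f x ∂[mul ℝ ℂ; μ] := rfl

theorem integralL1_indicatorConstLp (μ : ComplexMeasure X) {lam : Measure X} [IsFiniteMeasure lam]
    {c : ℝ≥0} (h : μ.variation ≤ c • lam) {s : Set X} (hs : MeasurableSet s) :
    integralL1 μ h (indicatorConstLp 1 hs (measure_ne_top lam s) 1) = μ s := by
  rw [integralL1_apply, VectorMeasure.integral_congr_ae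
    ((Measure.absolutelyContinuous_of_le_smul h).ae_eq indicatorConstLp_coeFn),
    VectorMeasure.integral_indicator_const _ hs]
  simp

theorem enorm_apply_indicatorConstLp_le {lam : Measure X} [IsFiniteMeasure lam]
    (G : StrongDual ℂ (X →₁[lam] ℂ)) {s : Set X} (hs : MeasurableSet s) :
    ‖G (indicatorConstLp 1 hs (measure_ne_top lam s) 1)‖ₑ ≤ (‖G‖₊ • lam) s := by
  calc ‖G (indicatorConstLp 1 hs (measure_ne_top lam s) 1)‖ₑ
      ≤ ‖G‖ₑ * ‖indicatorConstLp 1 hs (measure_ne_top lam s) (1 : ℂ)‖ₑ := G.le_opENorm _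
    _ ≤ ‖G‖ₑ * lam s := by
        gcongr
        simpa using enorm_indicatorConstLp_le (p := 1) (hs := hs) (c := (1 : ℂ))
    _ = (‖G‖₊ • lam) s := rfl

/-- The complex measure `s ↦ G 1_s` of a bounded functional `G` on `L¹`. -/
def measureOfL1 {lam : Measure X} [IsFiniteMeasure lam] (G : StrongDual ℂ (X →₁[lam] ℂ)) :
    ComplexMeasure X :=
  open scoped Classical in
  VectorMeasure.of_additive_of_le_measure (μ := ‖G‖₊ • lam)
    (fun s => if hs : MeasurableSet s then
      G (indicatorConstLp 1 hs (measure_ne_top lam s) 1) else 0)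
    (fun s => by
      split_ifs with hs
      · exact enorm_apply_indicatorConstLp_le G hs
      · simp)
    (fun s t hs ht hst => by
      rw [dif_pos hs, dif_pos ht, dif_pos (hs.union ht), ← map_add,
        indicatorConstLp_disjoint_union hs ht (measure_ne_top lam s) (measure_ne_top lam t) hst])
    (fun _ hs => dif_neg hs)

theorem measureOfL1_apply {lam : Measure X} [IsFiniteMeasure lam] (G : StrongDual ℂ (X →₁[lam] ℂ))
    {s : Set X} (hs : MeasurableSet s) :
    measureOfL1 G s = G (indicatorConstLp 1 hs (measure_ne_top lam s) 1) := dif_pos hs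

theorem variation_measureOfL1_le {lam : Measure X} [IsFiniteMeasure lam]
    (G : StrongDual ℂ (X →₁[lam] ℂ)) : (measureOfL1 G).variation ≤ ‖G‖₊ • lam :=
  VectorMeasure.variation_le_of_forall_enorm_le fun s hs => by
    rw [measureOfL1_apply G hs]
    exact enorm_apply_indicatorConstLp_le G hs

theorem integralL1_measureOfL1 {lam : Measure X} [IsFiniteMeasure lam]
    (G : StrongDual ℂ (X →₁[lam] ℂ)) :
    integralL1 (measureOfL1 G) (variation_measureOfL1_le G) = G :=
  L1_functional_ext fun s hs => by rw [integralL1_indicatorConstLp, measureOfL1_apply]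

theorem integral_smul_complexMeasure (c : ℂ) {μ : ComplexMeasure X} {f : X → ℂ}
    (hf : μ.Integrable f) : ∫ᵛ x, f x ∂[mul ℝ ℂ; c • μ] = c * ∫ᵛ x, f x ∂[mul ℝ ℂ; μ] := by
  have hμ : μ.variation ≤ (1 : ℝ≥0) • μ.variation := (one_smul _ _).ge
  have hcμ : (c • μ).variation ≤ ‖c‖₊ • μ.variation := VectorMeasure.variation_smul.le
  have key : integralL1 (c • μ) hcμ = c • integralL1 μ hμ :=
    L1_functional_ext fun s hs => by simp [integralL1_indicatorConstLp]
  calc ∫ᵛ x, f x ∂[mul ℝ ℂ; c • μ] = integralL1 (c • μ) hcμ (hf.toL1 f) :=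
        (VectorMeasure.integral_congr_ae
          ((Measure.absolutelyContinuous_of_le_smul hcμ).ae_eq hf.coeFn_toL1)).symm
    _ = c * integralL1 μ hμ (hf.toL1 f) := by rw [key]; rfl
    _ = c * ∫ᵛ x, f x ∂[mul ℝ ℂ; μ] := by
        rw [integralL1_apply, VectorMeasure.integral_congr_ae hf.coeFn_toL1]

theorem variation_prod_mul_le (μ : ComplexMeasure X) (ν : ComplexMeasure Y) :
    (μ.prod ν (mul ℝ ℂ)).variation ≤ μ.variation.prod ν.variation := by
  simpa [enorm_eq_nnnorm] using VectorMeasure.variation_prod_le (μ := μ) (ν := ν) (B := mul ℝ ℂ)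

theorem integrable_prod_mul {μ : ComplexMeasure X} {ν : ComplexMeasure Y} {f : X → ℂ} {g : Y → ℂ}
    (hf : μ.Integrable f) (hg : ν.Integrable g) :
    (μ.prod ν (mul ℝ ℂ)).Integrable fun p => f p.1 * g p.2 :=
  (hf.mul_prod hg).mono_measure (variation_prod_mul_le μ ν)

theorem integral_prod_mul_congr {μ : ComplexMeasure X} {ν : ComplexMeasure Y} {f f' : X → ℂ}
    {g g' : Y → ℂ} (hf : f =ᵐ[μ.variation] f') (hg : g =ᵐ[ν.variation] g') :
    ∫ᵛ p, f p.1 * g p.2 ∂[mul ℝ ℂ; μ.prod ν (mul ℝ ℂ)] =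
      ∫ᵛ p, f' p.1 * g' p.2 ∂[mul ℝ ℂ; μ.prod ν (mul ℝ ℂ)] := by
  refine VectorMeasure.integral_congr_ae
    ((Measure.absolutelyContinuous_of_le (variation_prod_mul_le μ ν)).ae_eq ?_)
  filter_upwards [Measure.quasiMeasurePreserving_fst.ae_eq hf,
    Measure.quasiMeasurePreserving_snd.ae_eq hg] with p hfp hgp
  exact congrArg₂ (· * ·) hfp hgp

/-- The bounded bilinear form `(f, g) ↦ ∫ f(x) g(y) d(μ × ν)` on `L¹(|μ|) × L¹(|ν|)`. -/
def prodIntegral (μ : ComplexMeasure X) (ν : ComplexMeasure Y) :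
    (X →₁[μ.variation] ℂ) →L[ℂ] (Y →₁[ν.variation] ℂ) →L[ℂ] ℂ :=
  LinearMap.mkContinuous₂
    (LinearMap.mk₂ ℂ (fun f g => ∫ᵛ p, f p.1 * g p.2 ∂[mul ℝ ℂ; μ.prod ν (mul ℝ ℂ)])
      (fun f f' g => by
        rw [integral_prod_mul_congr (Lp.coeFn_add f f') .rfl, ← VectorMeasure.integral_fun_add
          (integrable_prod_mul (L1.integrable_coeFn f) (L1.integrable_coeFn g))
          (integrable_prod_mul (L1.integrable_coeFn f') (L1.integrable_coeFn g))]
        simp only [Pi.add_apply, add_mul])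
      (fun c f g => by
        rw [integral_prod_mul_congr (Lp.coeFn_smul c f) .rfl]
        simp only [Pi.smul_apply, smul_eq_mul, mul_assoc, integral_const_mul_complexMeasure])
      (fun f g g' => by
        rw [integral_prod_mul_congr .rfl (Lp.coeFn_add g g'), ← VectorMeasure.integral_fun_add
          (integrable_prod_mul (L1.integrable_coeFn f) (L1.integrable_coeFn g))
          (integrable_prod_mul (L1.integrable_coeFn f) (L1.integrable_coeFn g'))]
        simp only [Pi.add_apply, mul_add])
      (fun c f g => by
        rw [integral_prod_mul_congr .rfl (Lp.coeFn_smul c g)]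
        simp only [Pi.smul_apply, smul_eq_mul, mul_left_comm _ c,
          integral_const_mul_complexMeasure]))
    1 fun f g => by
      calc ‖∫ᵛ p, f p.1 * g p.2 ∂[mul ℝ ℂ; μ.prod ν (mul ℝ ℂ)]‖
          ≤ ∫ p, ‖f p.1 * g p.2‖ ∂(μ.prod ν (mul ℝ ℂ)).variation :=
            norm_integral_complexMeasure_le _ _
        _ ≤ ∫ p, ‖f p.1 * g p.2‖ ∂μ.variation.prod ν.variation :=
            integral_mono_measure (variation_prod_mul_le μ ν)
              (Eventually.of_forall fun _ => norm_nonneg _)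
              ((L1.integrable_coeFn f).mul_prod (L1.integrable_coeFn g)).norm
        _ = 1 * ‖f‖ * ‖g‖ := by
            simp only [norm_mul, integral_prod_mul (fun x => ‖f x‖) fun y => ‖g y‖,
              L1.norm_eq_integral_norm, one_mul]

theorem prodIntegral_indicatorConstLp (μ : ComplexMeasure X) (ν : ComplexMeasure Y) {s : Set X}
    {t : Set Y} (hs : MeasurableSet s) (ht : MeasurableSet t) :
    prodIntegral μ ν (indicatorConstLp 1 hs (measure_ne_top _ s) 1)
      (indicatorConstLp 1 ht (measure_ne_top _ t) 1) = μ s * ν t := by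
  have hst : (fun p : X × Y => s.indicator (fun _ => (1 : ℂ)) p.1 * t.indicator (fun _ => 1) p.2) =
      (s ×ˢ t).indicator fun _ => 1 :=
    funext fun _ => Set.indicator_prod_one.symm
  calc _ = ∫ᵛ p, s.indicator (fun _ => (1 : ℂ)) p.1 * t.indicator (fun _ => 1) p.2
        ∂[mul ℝ ℂ; μ.prod ν (mul ℝ ℂ)] :=
        integral_prod_mul_congr indicatorConstLp_coeFn indicatorConstLp_coeFn
    _ = μ s * ν t := by
        rw [hst, VectorMeasure.integral_indicator_const _ (hs.prod ht)]
        simp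

theorem integral_prod_mul_complexMeasure {μ : ComplexMeasure X} {ν : ComplexMeasure Y} {f : X → ℂ}
    {g : Y → ℂ} (hf : μ.Integrable f) (hg : ν.Integrable g) :
    ∫ᵛ p, f p.1 * g p.2 ∂[mul ℝ ℂ; μ.prod ν (mul ℝ ℂ)] =
      (∫ᵛ x, f x ∂[mul ℝ ℂ; μ]) * ∫ᵛ y, g y ∂[mul ℝ ℂ; ν] := by
  have hμ : μ.variation ≤ (1 : ℝ≥0) • μ.variation := (one_smul _ _).ge
  have hν : ν.variation ≤ (1 : ℝ≥0) • ν.variation := (one_smul _ _).ge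
  have key : prodIntegral μ ν (hf.toL1 f) (hg.toL1 g) =
      integralL1 μ hμ (hf.toL1 f) * integralL1 ν hν (hg.toL1 g) := by
    suffices h : (prodIntegral μ ν).flip (hg.toL1 g) =
        integralL1 ν hν (hg.toL1 g) • integralL1 μ hμ by
      simpa [mul_comm] using DFunLike.congr_fun h (hf.toL1 f)
    refine L1_functional_ext fun s hs => ?_
    suffices h : prodIntegral μ ν (indicatorConstLp 1 hs (measure_ne_top _ s) 1) =
        μ s • integralL1 ν hν by
      simpa [integralL1_indicatorConstLp, mul_comm] using DFunLike.congr_fun h (hg.toL1 g)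
    refine L1_functional_ext fun t ht => ?_
    simp [integralL1_indicatorConstLp, prodIntegral_indicatorConstLp]
  calc _ = prodIntegral μ ν (hf.toL1 f) (hg.toL1 g) :=
        (integral_prod_mul_congr hf.coeFn_toL1 hg.coeFn_toL1).symm
    _ = integralL1 μ hμ (hf.toL1 f) * integralL1 ν hν (hg.toL1 g) := key
    _ = _ := congrArg₂ (· * ·) (VectorMeasure.integral_congr_ae hf.coeFn_toL1)
        (VectorMeasure.integral_congr_ae hg.coeFn_toL1)

end ComplexIntegral

section DualVariation

variable {X : Type*} [TopologicalSpace X]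

/-- The variation `|F|(f) = sup {|F g| : |g| ≤ f}` of a bounded functional `F` on `C(X)`, at a
nonnegative function `f`. -/
def dualVariation (F : StrongDual ℂ C(X, ℂ)) (f : C(X, ℝ≥0)) : ℝ≥0 :=
  ⨆ g : {g : C(X, ℂ) // ∀ x, ‖g x‖₊ ≤ f x}, ‖F g‖₊

instance (f : C(X, ℝ≥0)) : Nonempty {g : C(X, ℂ) // ∀ x, ‖g x‖₊ ≤ f x} :=
  ⟨⟨0, fun x => by simp⟩⟩

theorem dualVariation_le (F : StrongDual ℂ C(X, ℂ)) {f : C(X, ℝ≥0)} {a : ℝ≥0}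
    (h : ∀ g : C(X, ℂ), (∀ x, ‖g x‖₊ ≤ f x) → ‖F g‖₊ ≤ a) : dualVariation F f ≤ a :=
  ciSup_le fun g => h g g.2

theorem add_dualVariation_le (F : StrongDual ℂ C(X, ℂ)) {f : C(X, ℝ≥0)} {a b : ℝ≥0}
    (h : ∀ g : C(X, ℂ), (∀ x, ‖g x‖₊ ≤ f x) → a + ‖F g‖₊ ≤ b) : a + dualVariation F f ≤ b :=
  add_le_of_le_tsub_left_of_le (le_self_add.trans (h 0 fun x => by simp))
    (dualVariation_le F fun g hg => le_tsub_of_add_le_left (h g hg))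

theorem exists_eq_add_add_of_nnnorm_le {f₁ f₂ : C(X, ℝ≥0)} {g : C(X, ℂ)}
    (hg : ∀ x, ‖g x‖₊ ≤ f₁ x + f₂ x) {δ : ℝ≥0} (hδ : 0 < δ) :
    ∃ g₁ g₂ g₃ : C(X, ℂ), g = g₁ + g₂ + g₃ ∧
      (∀ x, ‖g₁ x‖₊ ≤ f₁ x) ∧ (∀ x, ‖g₂ x‖₊ ≤ f₂ x) ∧ ∀ x, ‖g₃ x‖₊ ≤ δ := by
  have hpos (x : X) : f₁ x + f₂ x + δ ≠ 0 := (by positivity : 0 < f₁ x + f₂ x + δ).ne'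
  let q (f : C(X, ℝ≥0)) : C(X, ℝ≥0) :=
    ⟨fun x => f x / (f₁ x + f₂ x + δ), f.continuous.div (by fun_prop) hpos⟩
  let G (f : C(X, ℝ≥0)) : C(X, ℂ) := ⟨fun x => ((q f x : ℝ) : ℂ) * g x, by fun_prop⟩
  have hG (f : C(X, ℝ≥0)) (x : X) : ‖G f x‖₊ ≤ f x := by
    calc ‖G f x‖₊ = f x / (f₁ x + f₂ x + δ) * ‖g x‖₊ := by
          simp only [G, q, ContinuousMap.coe_mk, nnnorm_mul, Complex.nnnorm_real, NNReal.nnnorm_eq]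
      _ ≤ f x / (f₁ x + f₂ x + δ) * (f₁ x + f₂ x + δ) := by
          gcongr
          exact (hg x).trans le_self_add
      _ = f x := div_mul_cancel₀ _ (hpos x)
  refine ⟨G f₁, G f₂, G (.const X δ), ?_, hG f₁, hG f₂, hG _⟩
  ext x
  have hq : q f₁ x + q f₂ x + q (.const X δ) x = 1 := by
    simp only [q, ContinuousMap.coe_mk, ContinuousMap.const_apply, ← add_div, div_self (hpos x)]
  have hqℂ : ((q f₁ x : ℝ) : ℂ) + ((q f₂ x : ℝ) : ℂ) + ((q (.const X δ) x : ℝ) : ℂ) = 1 := by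
    exact_mod_cast hq
  simp only [G, ContinuousMap.add_apply, ContinuousMap.coe_mk, ← add_mul, hqℂ, one_mul]

variable [CompactSpace X]

theorem nnnorm_apply_le_of_forall_le (F : StrongDual ℂ C(X, ℂ)) {g : C(X, ℂ)} {C : ℝ≥0}
    (hg : ∀ x, ‖g x‖₊ ≤ C) : ‖F g‖₊ ≤ ‖F‖₊ * C :=
  (F.le_opNNNorm g).trans (by gcongr; exact (ContinuousMap.norm_le _ C.2).2 hg)

theorem le_dualVariation (F : StrongDual ℂ C(X, ℂ)) {f : C(X, ℝ≥0)} {g : C(X, ℂ)}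
    (hg : ∀ x, ‖g x‖₊ ≤ f x) : ‖F g‖₊ ≤ dualVariation F f := by
  obtain ⟨C, hC⟩ := (isCompact_range f.continuous).bddAbove
  have hbdd : BddAbove (Set.range fun g : {g : C(X, ℂ) // ∀ x, ‖g x‖₊ ≤ f x} => ‖F g‖₊) :=
    ⟨‖F‖₊ * C, Set.forall_mem_range.2 fun g =>
      nnnorm_apply_le_of_forall_le F fun x => (g.2 x).trans (hC ⟨x, rfl⟩)⟩
  exact le_ciSup hbdd ⟨g, hg⟩

theorem dualVariation_add_le (F : StrongDual ℂ C(X, ℂ)) (f₁ f₂ : C(X, ℝ≥0)) :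
    dualVariation F (f₁ + f₂) ≤ dualVariation F f₁ + dualVariation F f₂ := by
  refine dualVariation_le F fun g hg => le_of_forall_pos_le_add fun ε hε => ?_
  have hδ : ‖F‖₊ * (ε / (‖F‖₊ + 1)) ≤ ε := by
    rw [mul_div_left_comm]
    exact mul_le_of_le_one_right' (div_le_one_of_le₀ le_self_add (by positivity))
  obtain ⟨g₁, g₂, g₃, rfl, hg₁, hg₂, hg₃⟩ :=
    exists_eq_add_add_of_nnnorm_le hg (δ := ε / (‖F‖₊ + 1)) (by positivity)
  calc ‖F (g₁ + g₂ + g₃)‖₊ ≤ ‖F g₁‖₊ + ‖F g₂‖₊ + ‖F g₃‖₊ := by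
        rw [map_add, map_add]
        exact (nnnorm_add_le _ _).trans (add_le_add_left (nnnorm_add_le _ _) _)
    _ ≤ dualVariation F f₁ + dualVariation F f₂ + ε := by
        gcongr
        · exact le_dualVariation F hg₁
        · exact le_dualVariation F hg₂
        · exact (nnnorm_apply_le_of_forall_le F hg₃).trans hδ

theorem nnnorm_add_nnnorm_le_dualVariation (F : StrongDual ℂ C(X, ℂ)) {f₁ f₂ : C(X, ℝ≥0)}
    {g₁ g₂ : C(X, ℂ)} (hg₁ : ∀ x, ‖g₁ x‖₊ ≤ f₁ x) (hg₂ : ∀ x, ‖g₂ x‖₊ ≤ f₂ x) :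
    ‖F g₁‖₊ + ‖F g₂‖₊ ≤ dualVariation F (f₁ + f₂) := by
  obtain ⟨c₁, hc₁, h₁⟩ := Complex.exists_norm_eq_mul_self (F g₁)
  obtain ⟨c₂, hc₂, h₂⟩ := Complex.exists_norm_eq_mul_self (F g₂)
  have hsum : F (c₁ • g₁ + c₂ • g₂) = ((‖F g₁‖ + ‖F g₂‖ : ℝ) : ℂ) := by
    simp [h₁, h₂]
  calc ‖F g₁‖₊ + ‖F g₂‖₊ = ‖F (c₁ • g₁ + c₂ • g₂)‖₊ := by
        rw [hsum, ← NNReal.coe_inj, coe_nnnorm, Complex.norm_of_nonneg (by positivity)]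
        rfl
    _ ≤ dualVariation F (f₁ + f₂) := le_dualVariation F fun x => by
        refine (nnnorm_add_le _ _).trans (add_le_add ?_ ?_)
        · simpa [← NNReal.coe_le_coe, hc₁] using hg₁ x
        · simpa [← NNReal.coe_le_coe, hc₂] using hg₂ x

theorem dualVariation_add (F : StrongDual ℂ C(X, ℂ)) (f₁ f₂ : C(X, ℝ≥0)) :
    dualVariation F (f₁ + f₂) = dualVariation F f₁ + dualVariation F f₂ :=
  (dualVariation_add_le F f₁ f₂).antisymm <|
    add_dualVariation_le F fun g₂ hg₂ => by
      rw [add_comm]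
      refine add_dualVariation_le F fun g₁ hg₁ => ?_
      rw [add_comm]
      exact nnnorm_add_nnnorm_le_dualVariation F hg₁ hg₂

theorem mul_dualVariation_le (F : StrongDual ℂ C(X, ℂ)) (c : ℝ≥0) (f : C(X, ℝ≥0)) :
    c * dualVariation F f ≤ dualVariation F (c • f) := by
  rw [dualVariation, NNReal.mul_iSup]
  refine ciSup_le fun g => ?_
  calc c * ‖F g‖₊ = ‖F (((c : ℝ) : ℂ) • (g : C(X, ℂ)))‖₊ := by simp
    _ ≤ dualVariation F (c • f) := le_dualVariation F fun x => by
        simpa [nnnorm_smul] using mul_le_mul_right (g.2 x) c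

theorem dualVariation_smul (F : StrongDual ℂ C(X, ℂ)) (c : ℝ≥0) (f : C(X, ℝ≥0)) :
    dualVariation F (c • f) = c * dualVariation F f := by
  refine le_antisymm ?_ (mul_dualVariation_le F c f)
  rcases eq_or_ne c 0 with rfl | hc
  · exact dualVariation_le F fun g hg => by
      simpa using nnnorm_apply_le_of_forall_le F (C := 0) (by simpa using hg)
  · calc dualVariation F (c • f) = c * (c⁻¹ * dualVariation F (c • f)) := by
          rw [mul_inv_cancel_left₀ hc]
      _ ≤ c * dualVariation F (c⁻¹ • c • f) := by
          gcongr
          exact mul_dualVariation_le F _ _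
      _ = c * dualVariation F f := by rw [inv_smul_smul₀ hc]

/-- The variation of a bounded functional on `C(X)`, as a positive linear functional. -/
def dualVariationLinear (F : StrongDual ℂ C(X, ℂ)) : C_c(X, ℝ≥0) →ₗ[ℝ≥0] ℝ≥0 where
  toFun f := dualVariation F f
  map_add' f g := dualVariation_add F f g
  map_smul' c f := dualVariation_smul F c f

variable [T2Space X] [MeasurableSpace X] [BorelSpace X]

/-- The positive measure representing the variation of a bounded functional on `C(X)`. -/
def dualVariationMeasure (F : StrongDual ℂ C(X, ℂ)) : Measure X :=
  NNRealRMK.rieszMeasure (dualVariationLinear F)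

instance (F : StrongDual ℂ C(X, ℂ)) : (dualVariationMeasure F).Regular :=
  NNRealRMK.rieszMeasure_regular _

theorem lintegral_dualVariationMeasure (F : StrongDual ℂ C(X, ℂ)) (f : C(X, ℝ≥0)) :
    ∫⁻ x, f x ∂dualVariationMeasure F = dualVariation F f :=
  NNRealRMK.lintegral_rieszMeasure (dualVariationLinear F)
    (CompactlySupportedContinuousMap.continuousMapEquiv f)

theorem dualVariationMeasure_univ_le (F : StrongDual ℂ C(X, ℂ)) :
    dualVariationMeasure F Set.univ ≤ ‖F‖ₑ := by
  calc dualVariationMeasure F Set.univ = dualVariation F 1 := by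
        simp [← lintegral_dualVariationMeasure]
    _ ≤ ‖F‖ₑ := by
        rw [enorm_eq_nnnorm, ENNReal.coe_le_coe]
        exact dualVariation_le F fun g hg =>
          (nnnorm_apply_le_of_forall_le F hg).trans_eq (mul_one _)

theorem enorm_apply_le_lintegral (F : StrongDual ℂ C(X, ℂ)) (g : C(X, ℂ)) :
    ‖F g‖ₑ ≤ ∫⁻ x, ‖g x‖ₑ ∂dualVariationMeasure F := by
  let f : C(X, ℝ≥0) := ⟨fun x => ‖g x‖₊, by fun_prop⟩
  calc ‖F g‖ₑ ≤ dualVariation F f := ENNReal.coe_le_coe.2 (le_dualVariation F fun _ => le_rfl)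
    _ = ∫⁻ x, ‖g x‖ₑ ∂dualVariationMeasure F := (lintegral_dualVariationMeasure F f).symm

end DualVariation

section Riesz

variable {X : Type*} [TopologicalSpace X] [CompactSpace X] [MeasurableSpace X] [BorelSpace X]

theorem integrable_continuousMap (μ : ComplexMeasure X) (f : C(X, ℂ)) : μ.Integrable f :=
  f.continuous.integrable_of_hasCompactSupport (HasCompactSupport.of_compactSpace f)

theorem integralL1_toLp (μ : ComplexMeasure X) {lam : Measure X} [IsFiniteMeasure lam] {c : ℝ≥0}
    (h : μ.variation ≤ c • lam) (f : C(X, ℂ)) :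
    integralL1 μ h (ContinuousMap.toLp 1 lam ℂ f) = ∫ᵛ x, f x ∂[mul ℝ ℂ; μ] :=
  VectorMeasure.integral_congr_ae
    ((Measure.absolutelyContinuous_of_le_smul h).ae_eq (ContinuousMap.coeFn_toLp lam f))

/-- The functional `f ↦ ∫ f dμ` on `C(X)`, as a linear function of the complex measure `μ`. -/
def integralDual : ComplexMeasure X →ₗ[ℂ] StrongDual ℂ C(X, ℂ) where
  toFun μ := integralL1 μ (one_smul ℝ≥0 μ.variation).ge ∘L ContinuousMap.toLp 1 μ.variation ℂ
  map_add' μ ν := by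
    ext f
    simp only [ContinuousLinearMap.comp_apply, add_apply, integralL1_toLp]
    exact VectorMeasure.integral_add_vectorMeasure (integrable_continuousMap μ f)
      (integrable_continuousMap ν f)
  map_smul' c μ := by
    ext f
    simp only [ContinuousLinearMap.comp_apply, smul_apply, integralL1_toLp]
    exact integral_smul_complexMeasure c (integrable_continuousMap μ f)

theorem integralDual_apply (μ : ComplexMeasure X) (f : C(X, ℂ)) :
    integralDual μ f = ∫ᵛ x, f x ∂[mul ℝ ℂ; μ] :=
  integralL1_toLp μ (one_smul ℝ≥0 μ.variation).ge f

theorem norm_integralDual_le (μ : ComplexMeasure X) :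
    ‖integralDual μ‖ ≤ μ.variation.real Set.univ :=
  ContinuousLinearMap.opNorm_le_bound _ measureReal_nonneg fun f => by
    calc ‖integralDual μ f‖ ≤ ∫ x, ‖f x‖ ∂μ.variation := by
          rw [integralDual_apply]
          exact norm_integral_complexMeasure_le μ f
      _ ≤ ∫ _, ‖f‖ ∂μ.variation :=
          integral_mono (integrable_continuousMap μ f).norm (integrable_const _) f.norm_coe_le_norm
      _ = μ.variation.real Set.univ * ‖f‖ := by simp

theorem exists_L1_extension [NormalSpace X] {lam : Measure X} [IsFiniteMeasure lam]
    [lam.WeaklyRegular] {F : StrongDual ℂ C(X, ℂ)}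
    (hF : ∀ g : C(X, ℂ), ‖F g‖ₑ ≤ ∫⁻ x, ‖g x‖ₑ ∂lam) :
    ∃ G : StrongDual ℂ (X →₁[lam] ℂ), ‖G‖ ≤ 1 ∧
      ∀ g : C(X, ℂ), G (ContinuousMap.toLp 1 lam ℂ g) = F g := by
  let ι : C(X, ℂ) →L[ℂ] (X →₁[lam] ℂ) := ContinuousMap.toLp 1 lam ℂ
  have hdense : DenseRange ι := ContinuousMap.toLp_denseRange ℂ lam ℂ (by simp)
  have hbound (g : C(X, ℂ)) : ‖F.toLinearMap g‖ ≤ 1 * ‖ι.toLinearMap g‖ := by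
    have h : ‖F g‖ₑ ≤ ‖ι g‖ₑ := by
      rw [Lp.enorm_def, eLpNorm_congr_ae (ContinuousMap.coeFn_toLp lam g),
        eLpNorm_one_eq_lintegral_enorm]
      exact hF g
    rw [one_mul]
    exact enorm_le_iff_norm_le.1 h
  exact ⟨F.toLinearMap.extendOfNorm ι.toLinearMap,
    LinearMap.opNorm_extendOfNorm_le hdense zero_le_one hbound,
    LinearMap.extendOfNorm_eq hdense ⟨1, hbound⟩⟩

theorem exists_integralDual_eq [T2Space X] (F : StrongDual ℂ C(X, ℂ)) :
    ∃ μ : ComplexMeasure X, integralDual μ = F ∧ μ.variation.real Set.univ ≤ ‖F‖ := by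
  let lam := dualVariationMeasure F
  have hlam : lam Set.univ ≤ ‖F‖ₑ := dualVariationMeasure_univ_le F
  have : IsFiniteMeasure lam := ⟨hlam.trans_lt enorm_lt_top⟩
  obtain ⟨G, hG, hGF⟩ := exists_L1_extension (enorm_apply_le_lintegral F)
  refine ⟨measureOfL1 G, ?_, ?_⟩
  · ext g
    rw [integralDual_apply, ← integralL1_toLp _ (variation_measureOfL1_le G),
      integralL1_measureOfL1, hGF]
  · have hle : (measureOfL1 G).variation Set.univ ≤ ‖F‖ₑ := by
      calc (measureOfL1 G).variation Set.univ ≤ ‖G‖₊ * lam Set.univ :=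
            variation_measureOfL1_le G Set.univ
        _ ≤ 1 * ‖F‖ₑ := by
            gcongr
            exact ENNReal.coe_le_one_iff.2 hG
        _ = ‖F‖ₑ := one_mul _
    simpa [measureReal_def] using ENNReal.toReal_mono enorm_ne_top hle

variable [TopologicalSpace.MetrizableSpace X]

theorem integralDual_injective :
    Function.Injective (integralDual : ComplexMeasure X →ₗ[ℂ] StrongDual ℂ C(X, ℂ)) := by
  refine (injective_iff_map_eq_zero _).2 fun μ hμ => ?_
  have hμ₁ : integralL1 μ (one_smul ℝ≥0 μ.variation).ge = 0 :=
    ContinuousLinearMap.coeFn_injective <|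
      (ContinuousMap.toLp_denseRange ℂ μ.variation ℂ (by simp)).equalizer
        (ContinuousLinearMap.continuous _) continuous_const
        (funext fun f => DFunLike.congr_fun hμ f)
  ext s hs
  rw [← integralL1_indicatorConstLp μ (one_smul ℝ≥0 μ.variation).ge hs, hμ₁]
  rfl

/-- The **Riesz representation theorem** on a compact metrizable space: complex measures are the
dual of `C(X)`. -/
def rieszEquiv : ComplexMeasure X ≃ₗ[ℂ] StrongDual ℂ C(X, ℂ) :=
  LinearEquiv.ofBijective integralDual
    ⟨integralDual_injective, fun F => (exists_integralDual_eq F).imp fun _ => And.left⟩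

theorem rieszEquiv_apply (μ : ComplexMeasure X) (f : C(X, ℂ)) :
    rieszEquiv μ f = ∫ᵛ x, f x ∂[mul ℝ ℂ; μ] :=
  integralDual_apply μ f

theorem norm_rieszEquiv (μ : ComplexMeasure X) : ‖rieszEquiv μ‖ = μ.variation.real Set.univ := by
  refine (norm_integralDual_le μ).antisymm ?_
  obtain ⟨ν, hν, hνle⟩ := exists_integralDual_eq (integralDual μ)
  rwa [integralDual_injective hν] at hνle

end Riesz

section Monomial

theorem adjoin_singleton_subset_span_range {A ι : Type*} [Ring A] [StarRing A] [Algebra ℂ A]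
    [StarModule ℂ A] {a : A} {v : ι → A} (one : 1 ∈ Set.range v) (gen : a ∈ Set.range v)
    (star_mem : ∀ i, star (v i) ∈ Set.range v) (mul_mem : ∀ i j, v i * v j ∈ Set.range v) :
    (StarAlgebra.adjoin ℂ {a} : Set A) ⊆ Submodule.span ℂ (Set.range v) := by
  have hcl : (Submonoid.closure ({a} ∪ star {a}) : Set A) ⊆ Set.range v := by
    intro x hx
    induction hx using Submonoid.closure_induction with
    | one => exact one
    | mul x y _ _ hx hy =>
      obtain ⟨i, rfl⟩ := hx
      obtain ⟨j, rfl⟩ := hy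
      exact mul_mem i j
    | mem x hx =>
      rw [Set.star_singleton] at hx
      rcases hx with rfl | rfl
      · exact gen
      · obtain ⟨i, rfl⟩ := gen
        exact star_mem i
  intro x hx
  have : x ∈ Subalgebra.toSubmodule (StarAlgebra.adjoin ℂ {a}).toSubalgebra := hx
  rw [StarAlgebra.adjoin_eq_span] at this
  exact Submodule.span_mono hcl this

theorem star_shift_mul_shift : star shift * shift = 1 :=
  (ContinuousLinearMap.norm_map_iff_adjoint_comp_self shift).1 shiftIsometry.norm_map

theorem star_shift_pow_mul_shift_pow (n : ℕ) : star shift ^ n * shift ^ n = 1 :=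
  pow_mul_pow_eq_one n star_shift_mul_shift

theorem monomial_zero_zero : monomial 0 0 = 1 := by
  simp only [monomial, pow_zero, mul_one]

theorem star_monomial (n m : ℕ) : star (monomial n m) = monomial m n := by
  simp only [monomial, star_mul, star_pow, star_star]

theorem monomial_mul (n m k l : ℕ) :
    monomial n m * monomial k l = monomial (n + (k - m)) (l + (m - k)) := by
  simp only [monomial]
  rcases le_total m k with h | h
  · obtain ⟨d, rfl⟩ := Nat.exists_eq_add_of_le h
    calc shift ^ n * star shift ^ m * (shift ^ (m + d) * star shift ^ l)
        = shift ^ n * (star shift ^ m * shift ^ m) * shift ^ d * star shift ^ l := by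
          rw [pow_add]
          noncomm_ring
      _ = shift ^ (n + (m + d - m)) * star shift ^ (l + (m - (m + d))) := by
          simp [star_shift_pow_mul_shift_pow, pow_add]
  · obtain ⟨d, rfl⟩ := Nat.exists_eq_add_of_le h
    calc shift ^ n * star shift ^ (k + d) * (shift ^ k * star shift ^ l)
        = shift ^ n * star shift ^ d * (star shift ^ k * shift ^ k) * star shift ^ l := by
          rw [add_comm k d, pow_add]
          noncomm_ring
      _ = shift ^ (n + (k - (k + d))) * star shift ^ (l + (k + d - k)) := by
          simp [star_shift_pow_mul_shift_pow, mul_assoc, ← pow_add, add_comm l d]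

theorem Tmon_mul (n m k l : ℕ) : Tmon n m * Tmon k l = Tmon (n + (k - m)) (l + (m - k)) :=
  Subtype.ext (monomial_mul n m k l)

theorem star_Tmon (n m : ℕ) : star (Tmon n m) = Tmon m n :=
  Subtype.ext (star_monomial n m)

theorem toeplitz_subset_closure_span_monomial :
    (toeplitz : Set (Ell2 →L[ℂ] Ell2)) ⊆
      closure (Submodule.span ℂ (Set.range fun p : ℕ × ℕ => monomial p.1 p.2)) :=
  closure_mono <| adjoin_singleton_subset_span_range ⟨(0, 0), monomial_zero_zero⟩
    ⟨(1, 0), by simp only [monomial, pow_one, pow_zero, mul_one]⟩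
    (fun p => ⟨(p.2, p.1), (star_monomial p.1 p.2).symm⟩)
    fun p q => ⟨(_, _), (monomial_mul p.1 p.2 q.1 q.2).symm⟩

theorem dense_span_Tmon :
    Dense (Submodule.span ℂ (Set.range fun p : ℕ × ℕ => Tmon p.1 p.2) : Set toeplitz) := by
  rw [Subtype.dense_iff]
  refine toeplitz_subset_closure_span_monomial.trans (closure_mono ?_)
  have hmap := Submodule.map_span (Subalgebra.toSubmodule toeplitz.toSubalgebra).subtype
    (Set.range fun p : ℕ × ℕ => Tmon p.1 p.2)
  rw [← Set.range_comp] at hmap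
  exact (SetLike.coe_set_eq.2 hmap).ge

theorem toeplitz_ext {F : Type*} [NormedAddCommGroup F] [NormedSpace ℂ F]
    {f g : toeplitz →L[ℂ] F} (h : ∀ n m, f (Tmon n m) = g (Tmon n m)) : f = g :=
  ContinuousLinearMap.ext_on dense_span_Tmon (by rintro _ ⟨p, rfl⟩; exact h p.1 p.2)

end Monomial

section Coordinates

theorem stdBasis_eq_single {ι : Type*} [DecidableEq ι] (i : ι) :
    stdBasis ι i = lp.single 2 i (1 : ℂ) :=
  (HilbertBasis.repr_symm_single _ i).symm

theorem inner_stdBasis_left {ι : Type*} (i : ι) (x : lp (fun _ : ι => ℂ) 2) :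
    ⟪stdBasis ι i, x⟫_ℂ = x i :=
  (HilbertBasis.repr_apply_apply _ x i).symm

theorem star_shift_apply (x : Ell2) (n : ℕ) : star shift x n = x (n + 1) := by
  rw [← inner_stdBasis_left, ContinuousLinearMap.star_eq_adjoint,
    ContinuousLinearMap.adjoint_inner_right, shift_stdBasis, inner_stdBasis_left]

theorem one_sub_shift_mul_star_shift :
    1 - shift * star shift = InnerProductSpace.rankOne ℂ (stdBasis ℕ 0) (stdBasis ℕ 0) := by
  ext x n
  rw [InnerProductSpace.rankOne_apply, inner_stdBasis_left, stdBasis_eq_single]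
  cases n with
  | zero =>
    change x 0 - 0 = x 0 * lp.single (E := fun _ : ℕ => ℂ) 2 0 1 0
    simp
  | succ n =>
    change x (n + 1) - star shift x n = x 0 * lp.single (E := fun _ : ℕ => ℂ) 2 0 1 (n + 1)
    simp [star_shift_apply, lp.single_apply]

theorem isCompactOperator_rankOne {H K : Type*} [NormedAddCommGroup H] [InnerProductSpace ℂ H]
    [NormedAddCommGroup K] [InnerProductSpace ℂ K] (x : H) (y : K) :
    IsCompactOperator (InnerProductSpace.rankOne ℂ x y) := by
  rw [InnerProductSpace.rankOne_def']
  have hy : IsCompactOperator (innerSL ℂ y) := isCompactOperator_of_locallyCompactSpace_dom _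
  exact hy.clm_comp (ContinuousLinearMap.toSpanSingleton ℂ x)

theorem isCompactOperator_one_sub_shift_pow (j : ℕ) :
    IsCompactOperator (1 - shift ^ j * star shift ^ j : Ell2 →L[ℂ] Ell2) := by
  induction j with
  | zero => simpa using isCompactOperator_zero
  | succ j ih =>
    have hstep : (1 - shift ^ (j + 1) * star shift ^ (j + 1) : Ell2 →L[ℂ] Ell2) =
        (1 - shift ^ j * star shift ^ j) +
          shift ^ j * ((1 - shift * star shift) * star shift ^ j) := by
      rw [pow_succ, pow_succ']
      noncomm_ring
    have hrank : IsCompactOperator (1 - shift * star shift : Ell2 →L[ℂ] Ell2) :=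
      one_sub_shift_mul_star_shift ▸ isCompactOperator_rankOne _ _
    rw [hstep]
    exact ih.add ((hrank.comp_clm (star shift ^ j)).clm_comp (shift ^ j))

theorem isCompactOperator_monomial_sub (n m j : ℕ) :
    IsCompactOperator (monomial n m - monomial (n + j) (m + j)) := by
  have hfactor : monomial n m - monomial (n + j) (m + j) =
      shift ^ n * ((1 - shift ^ j * star shift ^ j) * star shift ^ m) := by
    rw [monomial, monomial, add_comm m j, pow_add, pow_add]
    noncomm_ring
  rw [hfactor]
  exact ((isCompactOperator_one_sub_shift_pow j).comp_clm (star shift ^ m)).clm_comp (shift ^ n)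

end Coordinates

section CirclePow

/-- The character `z ↦ z ^ k` of the circle, as a continuous function. -/
def circlePow (k : ℤ) : C(Circle, ℂ) :=
  ⟨fun z => ((z ^ k : Circle) : ℂ), continuous_subtype_val.comp (continuous_zpow k)⟩

theorem circlePow_apply (k : ℤ) (z : Circle) : circlePow k z = (z : ℂ) ^ k :=
  Circle.coe_zpow z k

theorem circlePow_apply_mul (k : ℤ) (z w : Circle) :
    circlePow k (z * w) = circlePow k z * circlePow k w := by
  simp only [circlePow_apply, Circle.coe_mul, mul_zpow]

theorem circlePow_zero : circlePow 0 = 1 := by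
  ext z
  rw [circlePow_apply, zpow_zero, ContinuousMap.one_apply]

theorem circlePow_mul (j k : ℤ) : circlePow j * circlePow k = circlePow (j + k) := by
  ext z
  simp only [ContinuousMap.mul_apply, circlePow_apply, zpow_add₀ (Circle.coe_ne_zero z)]

theorem star_circlePow (k : ℤ) : star (circlePow k) = circlePow (-k) := by
  ext z
  simp [circlePow_apply, ← Circle.coe_inv_eq_conj]

theorem circlePow_natCast (d : ℕ) : circlePow d = circlePow 1 ^ d := by
  ext z
  simp only [ContinuousMap.pow_apply, circlePow_apply, zpow_natCast, zpow_one]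

theorem dense_span_circlePow :
    Dense (Submodule.span ℂ (Set.range circlePow) : Set C(Circle, ℂ)) := by
  have hsep : (StarAlgebra.adjoin ℂ {circlePow 1}).SeparatesPoints := fun x y hxy =>
    ⟨circlePow 1, ⟨circlePow 1, StarAlgebra.self_mem_adjoin_singleton ℂ _, rfl⟩, by
      simpa only [circlePow_apply, zpow_one] using fun h => hxy (Circle.ext h)⟩
  have hadjoin : Dense (StarAlgebra.adjoin ℂ {circlePow 1} : Set C(Circle, ℂ)) := by
    rw [dense_iff_closure_eq, ← StarSubalgebra.topologicalClosure_coe,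
      ContinuousMap.starSubalgebra_topologicalClosure_eq_top_of_separatesPoints _ hsep,
      StarSubalgebra.coe_top]
  exact hadjoin.mono <| adjoin_singleton_subset_span_range ⟨0, circlePow_zero⟩ ⟨1, rfl⟩
    (fun k => ⟨-k, (star_circlePow k).symm⟩) fun j k => ⟨j + k, (circlePow_mul j k).symm⟩

end CirclePow

section UnitaryCalculus

variable {H : Type*} [NormedAddCommGroup H] [InnerProductSpace ℂ H] [CompleteSpace H]

/-- The inclusion of the spectrum of a unitary operator into the circle. -/
def spectrumToCircle (U : unitary (H →L[ℂ] H)) : C(spectrum ℂ (U : H →L[ℂ] H), Circle) where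
  toFun x := ⟨x, Unitary.spectrum_subset_circle U x.2⟩
  continuous_toFun := by fun_prop

/-- The continuous functional calculus `f ↦ f(U)` of a unitary operator, defined on all continuous
functions on the circle rather than on the spectrum, so that its source does not depend on `U`. -/
def unitaryCalculus (U : unitary (H →L[ℂ] H)) : C(Circle, ℂ) →⋆ₐ[ℂ] (H →L[ℂ] H) :=
  (cfcHom (p := IsStarNormal) (a := (U : H →L[ℂ] H)) inferInstance).comp
    (ContinuousMap.compStarAlgHom' ℂ ℂ (spectrumToCircle U))

theorem unitaryCalculus_circlePow_one (U : unitary (H →L[ℂ] H)) :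
    unitaryCalculus U (circlePow 1) = U := by
  have hid : ContinuousMap.compStarAlgHom' ℂ ℂ (spectrumToCircle U) (circlePow 1) =
      (ContinuousMap.id ℂ).restrict (spectrum ℂ (U : H →L[ℂ] H)) := by
    ext x
    exact (circlePow_apply 1 _).trans (zpow_one _)
  rw [unitaryCalculus, StarAlgHom.comp_apply, hid]
  exact cfcHom_id _

end UnitaryCalculus

section BilateralShift

/-- The Hilbert basis with the elements of `b` relabelled along `e`. -/
def reindexBasis {ι κ H : Type*} [NormedAddCommGroup H] [InnerProductSpace ℂ H] [CompleteSpace H]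
    (b : HilbertBasis ι ℂ H) (e : κ ≃ ι) : HilbertBasis κ ℂ H :=
  HilbertBasis.mk (b.orthonormal.comp e e.injective) <| by
    rw [e.surjective.range_comp]
    exact b.dense_span.ge

theorem reindexBasis_apply {ι κ H : Type*} [NormedAddCommGroup H] [InnerProductSpace ℂ H]
    [CompleteSpace H] (b : HilbertBasis ι ℂ H) (e : κ ≃ ι) (k : κ) :
    reindexBasis b e k = b (e k) := by
  rw [reindexBasis, HilbertBasis.coe_mk, Function.comp_apply]

/-- The Hilbert space `ℓ²(ℤ)`. -/
abbrev Ell2Int := lp (fun _ : ℤ => ℂ) 2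

/-- The bilateral shift `e_k ↦ e_{k+1}` of `ℓ²(ℤ)`, a unitary operator dilating `shift`. -/
def bilateralShift : unitary (Ell2Int →L[ℂ] Ell2Int) :=
  Unitary.linearIsometryEquiv.symm (reindexBasis (stdBasis ℤ) (Equiv.addRight 1)).repr.symm

theorem bilateralShift_stdBasis (k : ℤ) :
    (bilateralShift : Ell2Int →L[ℂ] Ell2Int) (stdBasis ℤ k) = stdBasis ℤ (k + 1) := by
  classical
  change (reindexBasis (stdBasis ℤ) (Equiv.addRight 1)).repr.symm (stdBasis ℤ k) = _
  rw [stdBasis_eq_single, HilbertBasis.repr_symm_single, reindexBasis_apply, Equiv.coe_addRight]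

/-- The inclusion `ℓ²(ℕ) → ℓ²(ℤ)`, extending sequences by zero. -/
def ell2Inclusion : Ell2 →ₗᵢ[ℂ] Ell2Int :=
  ((stdBasis ℤ).orthonormal.comp _ Nat.cast_injective).orthogonalFamily.linearIsometry

theorem ell2Inclusion_stdBasis (n : ℕ) : ell2Inclusion (stdBasis ℕ n) = stdBasis ℤ n := by
  rw [stdBasis_eq_single, ell2Inclusion, OrthogonalFamily.linearIsometry_apply_single,
    LinearIsometry.toSpanSingleton_apply, one_smul, Function.comp_apply]

theorem ell2Inclusion_shift (x : Ell2) :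
    ell2Inclusion (shift x) = (bilateralShift : Ell2Int →L[ℂ] Ell2Int) (ell2Inclusion x) := by
  have h : ell2Inclusion.toContinuousLinearMap ∘L shift =
      (bilateralShift : Ell2Int →L[ℂ] Ell2Int) ∘L ell2Inclusion.toContinuousLinearMap :=
    hilbertBasis_ext (stdBasis ℕ) fun n => by
      simp [shift_stdBasis, ell2Inclusion_stdBasis, bilateralShift_stdBasis]
  exact DFunLike.congr_fun h x

theorem ell2Inclusion_shift_pow (d : ℕ) (x : Ell2) :
    ell2Inclusion ((shift ^ d) x) =
      ((bilateralShift : Ell2Int →L[ℂ] Ell2Int) ^ d) (ell2Inclusion x) := by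
  induction d with
  | zero => rfl
  | succ d ih =>
    rw [pow_succ', pow_succ', mul_apply_eq_comp, mul_apply_eq_comp, ell2Inclusion_shift, ih]

end BilateralShift

section Compression

variable {H K : Type*} [NormedAddCommGroup H] [InnerProductSpace ℂ H] [CompleteSpace H]
  [NormedAddCommGroup K] [InnerProductSpace ℂ K] [CompleteSpace K]

/-- The compression `A ↦ V* A V` of operators along an isometry `V`. -/
def compression (V : H →ₗᵢ[ℂ] K) : (K →L[ℂ] K) →L[ℂ] (H →L[ℂ] H) :=
  ContinuousLinearMap.compL ℂ H K H (ContinuousLinearMap.adjoint V.toContinuousLinearMap) ∘L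
    (ContinuousLinearMap.compL ℂ H K K).flip V.toContinuousLinearMap

theorem compression_apply (V : H →ₗᵢ[ℂ] K) (A : K →L[ℂ] K) :
    compression V A =
      ContinuousLinearMap.adjoint V.toContinuousLinearMap ∘L A ∘L V.toContinuousLinearMap := rfl

theorem inner_compression_apply (V : H →ₗᵢ[ℂ] K) (A : K →L[ℂ] K) (x y : H) :
    ⟪x, compression V A y⟫_ℂ = ⟪V x, A (V y)⟫_ℂ := by
  rw [compression_apply, ContinuousLinearMap.comp_apply,
    ContinuousLinearMap.adjoint_inner_right]
  rfl

theorem compression_eq_of_intertwines {V : H →ₗᵢ[ℂ] K} {A : K →L[ℂ] K} {B : H →L[ℂ] H}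
    (h : ∀ x, V (B x) = A (V x)) : compression V A = B := by
  refine ContinuousLinearMap.ext fun y => ext_inner_left ℂ fun x => ?_
  rw [inner_compression_apply, ← h, V.inner_map_map]

theorem compression_star (V : H →ₗᵢ[ℂ] K) (A : K →L[ℂ] K) :
    compression V (star A) = star (compression V A) := by
  refine ContinuousLinearMap.ext fun y => ext_inner_left ℂ fun x => ?_
  rw [inner_compression_apply, ContinuousLinearMap.star_eq_adjoint,
    ContinuousLinearMap.star_eq_adjoint, ContinuousLinearMap.adjoint_inner_right,
    ContinuousLinearMap.adjoint_inner_right, ← inner_conj_symm, ← inner_compression_apply,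
    inner_conj_symm]

theorem norm_compression_apply_le (V : H →ₗᵢ[ℂ] K) (A : K →L[ℂ] K) :
    ‖compression V A‖ ≤ ‖A‖ := by
  have hV : ‖V.toContinuousLinearMap‖ ≤ 1 := V.norm_toContinuousLinearMap_le
  calc ‖compression V A‖
      ≤ ‖ContinuousLinearMap.adjoint V.toContinuousLinearMap‖ *
          (‖A‖ * ‖V.toContinuousLinearMap‖) :=
        (ContinuousLinearMap.opNorm_comp_le _ _).trans
          (mul_le_mul_of_nonneg_left (ContinuousLinearMap.opNorm_comp_le _ _) (norm_nonneg _))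
    _ ≤ 1 * (‖A‖ * 1) := by
        rw [LinearIsometryEquiv.norm_map]
        gcongr
    _ = ‖A‖ := by rw [one_mul, mul_one]

end Compression

section ToeplitzOperator

/-- The Toeplitz operator with symbol `f`, as the compression to `ℓ²(ℕ)` of the function `f` of the
adjoint of the bilateral shift. The adjoint is there because `monomial n m` is to have the symbol
`z ^ (m - n)`. -/
def toeplitzOp : C(Circle, ℂ) →L[ℂ] (Ell2 →L[ℂ] Ell2) :=
  compression ell2Inclusion ∘L
    (unitaryCalculus (star bilateralShift)).toAlgHom.toLinearMap.mkContinuous 1 fun f =>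
      (NonUnitalStarAlgHom.norm_apply_le (unitaryCalculus (star bilateralShift)) f).trans_eq
        (one_mul _).symm

theorem toeplitzOp_apply (f : C(Circle, ℂ)) :
    toeplitzOp f = compression ell2Inclusion (unitaryCalculus (star bilateralShift) f) := rfl

theorem norm_toeplitzOp_apply_le (f : C(Circle, ℂ)) : ‖toeplitzOp f‖ ≤ ‖f‖ := by
  rw [toeplitzOp_apply]
  exact (norm_compression_apply_le _ _).trans
    (NonUnitalStarAlgHom.norm_apply_le (unitaryCalculus (star bilateralShift)) f)

theorem toeplitzOp_star (f : C(Circle, ℂ)) : toeplitzOp (star f) = star (toeplitzOp f) := by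
  rw [toeplitzOp_apply, map_star, compression_star, toeplitzOp_apply]

theorem toeplitzOp_circlePow_natCast (d : ℕ) : toeplitzOp (circlePow d) = star shift ^ d := by
  have hpow : toeplitzOp (circlePow (-d)) = shift ^ d := by
    rw [← star_circlePow, toeplitzOp_apply, map_star, circlePow_natCast, map_pow,
      unitaryCalculus_circlePow_one, Unitary.coe_star, ← star_pow, star_star]
    exact compression_eq_of_intertwines (ell2Inclusion_shift_pow d)
  rw [← star_pow, ← hpow, ← toeplitzOp_star, star_circlePow, neg_neg]

theorem toeplitzOp_circlePow (k : ℤ) :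
    toeplitzOp (circlePow k) = monomial (-k).toNat k.toNat := by
  obtain ⟨d, rfl | rfl⟩ := k.eq_nat_or_neg
  · simp [toeplitzOp_circlePow_natCast, monomial]
  · rw [← star_circlePow, toeplitzOp_star, toeplitzOp_circlePow_natCast]
    simp [monomial]

theorem toeplitzOp_mem (f : C(Circle, ℂ)) : toeplitzOp f ∈ toeplitz := by
  have hspan : Submodule.span ℂ (Set.range circlePow) ≤
      (Subalgebra.toSubmodule toeplitz.toSubalgebra).comap toeplitzOp.toLinearMap := by
    rw [Submodule.span_le]
    rintro _ ⟨k, rfl⟩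
    change toeplitzOp (circlePow k) ∈ toeplitz
    exact toeplitzOp_circlePow k ▸ monomial_mem _ _
  exact dense_span_circlePow.induction hspan (isClosed_toeplitz.preimage toeplitzOp.continuous) f

/-- The Toeplitz operators as elements of the Toeplitz algebra. -/
def toeplitzLift : C(Circle, ℂ) →L[ℂ] toeplitz :=
  toeplitzOp.codRestrict (Subalgebra.toSubmodule toeplitz.toSubalgebra) toeplitzOp_mem

theorem isCompactOperator_monomial_sub_toeplitzOp (n m : ℕ) :
    IsCompactOperator (monomial n m - toeplitzOp (circlePow ((m : ℤ) - n))) := by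
  have h := isCompactOperator_monomial_sub (n - m) (m - n) (min n m)
  rw [show n - m + min n m = n by omega, show m - n + min n m = m by omega] at h
  rw [toeplitzOp_circlePow, show (-((m : ℤ) - n)).toNat = n - m by omega,
    show ((m : ℤ) - n).toNat = m - n by omega]
  simpa using h.neg

end ToeplitzOperator

section Weak

theorem equicontinuous_of_norm_le {α E : Type*} [NormedAddCommGroup E] [NormedSpace ℂ E]
    {F : α → StrongDual ℂ E} {C : ℝ} (hF : ∀ a, ‖F a‖ ≤ C) :
    Equicontinuous fun a => (F a : E → ℂ) := by
  have htfae := (NormedSpace.equicontinuous_TFAE F).out 1 5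
  exact htfae.2 ⟨C, hF⟩

theorem tendsto_apply_of_dense_span {α E : Type*} [NormedAddCommGroup E] [NormedSpace ℂ E]
    {l : Filter α} {F : α → StrongDual ℂ E} {f : StrongDual ℂ E} {C : ℝ} (hF : ∀ a, ‖F a‖ ≤ C)
    {s : Set E} (hs : Dense (Submodule.span ℂ s : Set E))
    (h : ∀ x ∈ s, Tendsto (fun a => F a x) l (𝓝 (f x))) (x : E) :
    Tendsto (fun a => F a x) l (𝓝 (f x)) := by
  refine hs.induction (fun y hy => ?_)
    ((equicontinuous_of_norm_le hF).isClosed_setOfPred_tendsto f.continuous) x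
  induction hy using Submodule.span_induction with
  | mem y hy => exact h y hy
  | zero => simpa only [map_zero] using tendsto_const_nhds
  | add y z _ _ hy hz => simpa only [map_add] using hy.add hz
  | smul c y _ hy => simpa only [map_smul] using hy.const_smul c

variable {α ι H : Type*} [NormedAddCommGroup H] [InnerProductSpace ℂ H]

theorem tendstoUniformlyOn_inner_of_isCompact {l : Filter α} {v : α → H} (hv : ∀ a, ‖v a‖ ≤ 1)
    (hweak : ∀ x, Tendsto (fun a => ⟪v a, x⟫_ℂ) l (𝓝 0)) {C : Set H} (hC : IsCompact C) :
    TendstoUniformlyOn (fun a x => ⟪v a, x⟫_ℂ) 0 l C := by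
  have hequi : Equicontinuous fun a x => ⟪v a, x⟫_ℂ :=
    equicontinuous_of_norm_le fun a => (innerSL_apply_norm ℂ (v a)).trans_le (hv a)
  have hpi := (EquicontinuousOn.tendsto_uniformOnFun_iff_pi' (𝔖 := {C})
    (by rintro K rfl; exact hC) (fun K _ => hequi.equicontinuousOn K) l 0).2
    (tendsto_pi_nhds.2 fun x => hweak x)
  exact UniformOnFun.tendsto_iff_tendstoUniformlyOn.1 hpi C rfl

theorem tendsto_inner_apply_of_isCompactOperator [CompleteSpace H] (b : HilbertBasis ι ℂ H)
    {l : Filter α} {v : α → H} (hv : ∀ a, ‖v a‖ ≤ 1)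
    (hb : ∀ i, Tendsto (fun a => ⟪v a, b i⟫_ℂ) l (𝓝 0)) {A : H →L[ℂ] H}
    (hA : IsCompactOperator A) : Tendsto (fun a => ⟪v a, A (v a)⟫_ℂ) l (𝓝 0) := by
  have hweak (x : H) : Tendsto (fun a => ⟪v a, x⟫_ℂ) l (𝓝 0) :=
    tendsto_apply_of_dense_span (F := fun a => innerSL ℂ (v a)) (f := 0) (C := 1)
      (fun a => (innerSL_apply_norm ℂ (v a)).trans_le (hv a))
      (Submodule.dense_iff_topologicalClosure_eq_top.2 b.dense_span)
      (by rintro _ ⟨i, rfl⟩; exact hb i) x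
  obtain ⟨C, hC, hAC⟩ := hA.image_closedBall_subset_compact 1
  have hunif := tendstoUniformlyOn_inner_of_isCompact hv hweak hC
  rw [Metric.tendstoUniformlyOn_iff] at hunif
  refine Metric.tendsto_nhds.2 fun ε hε => (hunif ε hε).mono fun a ha => ?_
  rw [dist_comm]
  exact ha _ (hAC ⟨v a, mem_closedBall_zero_iff.2 (hv a), rfl⟩)

end Weak

section SzegoKernel

open Complex UnitDisc

/-- The sequence `(w ^ n)`, an eigenvector of the backward shift. It is the Szegő kernel at the
point conjugate to `w`, in terms of Taylor coefficients. -/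
def szegoKernel (w : 𝔻) : Ell2 :=
  ⟨fun n => (w : ℂ) ^ n, memℓp_gen <| by
    simpa [← pow_mul, mul_comm] using summable_geometric_of_lt_one (sq_nonneg _)
      ((sq_lt_one_iff₀ (norm_nonneg _)).2 w.norm_lt_one)⟩

theorem szegoKernel_apply (w : 𝔻) (n : ℕ) : szegoKernel w n = (w : ℂ) ^ n := rfl

theorem star_shift_szegoKernel (w : 𝔻) : star shift (szegoKernel w) = (w : ℂ) • szegoKernel w := by
  ext n
  rw [star_shift_apply, szegoKernel_apply, pow_succ']
  rfl

theorem star_shift_pow_szegoKernel (w : 𝔻) (m : ℕ) :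
    (star shift ^ m) (szegoKernel w) = (w : ℂ) ^ m • szegoKernel w := by
  induction m with
  | zero => simp
  | succ m ih =>
    rw [pow_succ, mul_apply_eq_comp, star_shift_szegoKernel, map_smul, ih, smul_smul, pow_succ']

theorem norm_szegoKernel_sq (w : 𝔻) : ‖szegoKernel w‖ ^ 2 = (1 - ‖(w : ℂ)‖ ^ 2)⁻¹ := by
  have hw := (sq_lt_one_iff₀ (norm_nonneg _)).2 w.norm_lt_one
  rw [← tsum_geometric_of_lt_one (sq_nonneg _) hw]
  have h := lp.norm_rpow_eq_tsum (p := 2) (by norm_num) (szegoKernel w)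
  simpa [szegoKernel_apply, ← pow_mul, mul_comm _ 2] using h

/-- The unit vector in the direction of `szegoKernel w`. -/
def unitSzegoKernel (w : 𝔻) : Ell2 := (‖szegoKernel w‖⁻¹ : ℂ) • szegoKernel w

theorem szegoKernel_ne_zero (w : 𝔻) : szegoKernel w ≠ 0 := fun h => by
  have h0 : szegoKernel w 0 = 0 := by rw [h]; rfl
  rw [szegoKernel_apply, pow_zero] at h0
  exact one_ne_zero h0

theorem norm_unitSzegoKernel (w : 𝔻) : ‖unitSzegoKernel w‖ = 1 :=
  norm_smul_inv_norm (szegoKernel_ne_zero w)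

theorem inner_unitSzegoKernel_monomial (w : 𝔻) (n m : ℕ) :
    ⟪unitSzegoKernel w, monomial n m (unitSzegoKernel w)⟫_ℂ =
      starRingEnd ℂ (w : ℂ) ^ n * (w : ℂ) ^ m := by
  have hpow (j : ℕ) : (star shift ^ j) (unitSzegoKernel w) = (w : ℂ) ^ j • unitSzegoKernel w := by
    rw [unitSzegoKernel, map_smul, star_shift_pow_szegoKernel, smul_comm]
  have hadj : shift ^ n = ContinuousLinearMap.adjoint (star shift ^ n) := by
    rw [← ContinuousLinearMap.star_eq_adjoint, star_pow, star_star]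
  rw [monomial, mul_apply_eq_comp, hadj, ContinuousLinearMap.adjoint_inner_right, hpow, hpow,
    inner_smul_left, inner_smul_right, inner_self_eq_norm_sq_to_K, norm_unitSzegoKernel, map_pow]
  simp

variable (z : Circle)

/-- Convergence of points of the disc to the boundary point `z`. -/
def nhdsBoundary : Filter 𝔻 := comap (fun w => (w : ℂ)) (𝓝 (z : ℂ))

instance nhdsBoundary_neBot : (nhdsBoundary z).NeBot := by
  rw [nhdsBoundary, comap_neBot_iff_frequently]
  have hz : (z : ℂ) ∈ closure (Metric.ball 0 1) := by
    rw [closure_ball _ one_ne_zero, mem_closedBall_zero_iff, Circle.norm_coe]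
  exact (mem_closure_iff_frequently.1 hz).mono fun w hw => ⟨mk w (mem_ball_zero_iff.1 hw), rfl⟩

theorem tendsto_coe_nhdsBoundary : Tendsto (fun w : 𝔻 => (w : ℂ)) (nhdsBoundary z) (𝓝 z) :=
  tendsto_comap

theorem tendsto_inner_unitSzegoKernel_stdBasis (j : ℕ) :
    Tendsto (fun w => ⟪unitSzegoKernel w, stdBasis ℕ j⟫_ℂ) (nhdsBoundary z) (𝓝 0) := by
  have hnorm (w : 𝔻) : ‖szegoKernel w‖⁻¹ = √(1 - ‖(w : ℂ)‖ ^ 2) := by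
    rw [← Real.sqrt_sq (inv_nonneg.2 (norm_nonneg _)), inv_pow, norm_szegoKernel_sq, inv_inv]
  have hlim : Tendsto (fun w : 𝔻 => √(1 - ‖(w : ℂ)‖ ^ 2)) (nhdsBoundary z) (𝓝 0) := by
    have h := (((tendsto_coe_nhdsBoundary z).norm.pow 2).const_sub 1).sqrt
    rwa [Circle.norm_coe, one_pow, sub_self, Real.sqrt_zero] at h
  refine squeeze_zero_norm (fun w => ?_) hlim
  rw [norm_inner_symm, inner_stdBasis_left, ← hnorm]
  change ‖(‖szegoKernel w‖⁻¹ : ℂ) * (w : ℂ) ^ j‖ ≤ _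
  rw [norm_mul, norm_pow, norm_inv, norm_real, norm_norm]
  exact mul_le_of_le_one_right (by positivity) (pow_le_one₀ (norm_nonneg _) w.norm_lt_one.le)

theorem tendsto_inner_unitSzegoKernel_toeplitzOp (f : C(Circle, ℂ)) :
    Tendsto (fun w => ⟪unitSzegoKernel w, toeplitzOp f (unitSzegoKernel w)⟫_ℂ)
      (nhdsBoundary z) (𝓝 (f z)) := by
  let F (w : 𝔻) : StrongDual ℂ C(Circle, ℂ) :=
    innerSL ℂ (unitSzegoKernel w) ∘L
      ContinuousLinearMap.apply ℂ Ell2 (unitSzegoKernel w) ∘L toeplitzOp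
  have hF (w : 𝔻) : ‖F w‖ ≤ 1 := ContinuousLinearMap.opNorm_le_bound _ zero_le_one fun f =>
    calc ‖⟪unitSzegoKernel w, toeplitzOp f (unitSzegoKernel w)⟫_ℂ‖
        ≤ ‖unitSzegoKernel w‖ * (‖toeplitzOp f‖ * ‖unitSzegoKernel w‖) :=
          (norm_inner_le_norm _ _).trans
            (mul_le_mul_of_nonneg_left ((toeplitzOp f).le_opNorm _) (norm_nonneg _))
      _ ≤ 1 * ‖f‖ := by
          simpa only [norm_unitSzegoKernel, one_mul, mul_one] using norm_toeplitzOp_apply_le f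
  refine tendsto_apply_of_dense_span (f := ContinuousMap.evalCLM ℂ z) hF dense_span_circlePow ?_ f
  rintro _ ⟨k, rfl⟩
  have hz := tendsto_coe_nhdsBoundary z
  have hlim := (((continuous_conj.tendsto _).comp hz).pow (-k).toNat).mul (hz.pow k.toNat)
  have hval : starRingEnd ℂ (z : ℂ) ^ (-k).toNat * (z : ℂ) ^ k.toNat = circlePow k z := by
    rw [← Circle.coe_inv_eq_conj, Circle.coe_inv, circlePow_apply, inv_pow, ← zpow_natCast,
      ← zpow_natCast, ← zpow_neg, ← zpow_add₀ (Circle.coe_ne_zero z)]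
    congr 1
    omega
  rw [hval] at hlim
  refine hlim.congr fun w => ?_
  change _ = ⟪unitSzegoKernel w, toeplitzOp (circlePow k) (unitSzegoKernel w)⟫_ℂ
  rw [toeplitzOp_circlePow, inner_unitSzegoKernel_monomial]
  rfl

theorem norm_le_norm_toeplitzOp_add (f : C(Circle, ℂ)) {K : Ell2 →L[ℂ] Ell2}
    (hK : IsCompactOperator K) : ‖f‖ ≤ ‖toeplitzOp f + K‖ := by
  refine (ContinuousMap.norm_le f (norm_nonneg _)).2 fun z => ?_
  have hlim := (tendsto_inner_unitSzegoKernel_toeplitzOp z f).add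
    (tendsto_inner_apply_of_isCompactOperator (stdBasis ℕ)
      (fun w => (norm_unitSzegoKernel w).le) (tendsto_inner_unitSzegoKernel_stdBasis z) hK)
  rw [add_zero] at hlim
  refine le_of_tendsto hlim.norm (Eventually.of_forall fun w => ?_)
  rw [← inner_add_right]
  calc ‖⟪unitSzegoKernel w, (toeplitzOp f + K) (unitSzegoKernel w)⟫_ℂ‖
      ≤ ‖unitSzegoKernel w‖ * (‖toeplitzOp f + K‖ * ‖unitSzegoKernel w‖) :=
        (norm_inner_le_norm _ _).trans
          (mul_le_mul_of_nonneg_left ((toeplitzOp f + K).le_opNorm _) (norm_nonneg _))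
    _ = ‖toeplitzOp f + K‖ := by rw [norm_unitSzegoKernel, one_mul, mul_one]

end SzegoKernel

section Symbol

instance isClosed_compacts : IsClosed (compacts : Set toeplitz) :=
  (isClosed_setOfPred_isCompactOperator (σ₁₂ := RingHom.id ℂ) (M₁ := Ell2) (M₂ := Ell2)).preimage
    continuous_subtype_val

theorem mkQ_Tmon (n m : ℕ) :
    compacts.mkQ (Tmon n m) = compacts.mkQ (toeplitzLift (circlePow ((m : ℤ) - n))) :=
  (Submodule.Quotient.eq compacts).2 (isCompactOperator_monomial_sub_toeplitzOp n m)

theorem norm_mkQ_toeplitzLift (f : C(Circle, ℂ)) : ‖compacts.mkQ (toeplitzLift f)‖ = ‖f‖ := by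
  refine le_antisymm ((Submodule.Quotient.norm_mk_le _ _).trans (norm_toeplitzOp_apply_le f)) ?_
  refine (QuotientAddGroup.le_norm_iff (S := compacts.toAddSubgroup)).2 fun A hA => ?_
  have hmem : A - toeplitzLift f ∈ compacts := (Submodule.Quotient.eq compacts).1 hA
  calc ‖f‖ ≤ ‖toeplitzOp f + (A - toeplitzLift f : toeplitz)‖ := norm_le_norm_toeplitzOp_add f hmem
    _ = ‖toeplitzLift f + (A - toeplitzLift f)‖ := rfl
    _ = ‖A‖ := by rw [add_sub_cancel]

/-- The section `f ↦ [T_f]` of the symbol map, sending a function to the class of its Toeplitz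
operator. -/
def symbolSection : C(Circle, ℂ) →ₗᵢ[ℂ] toeplitz ⧸ compacts where
  toLinearMap := compacts.mkQ ∘ₗ toeplitzLift.toLinearMap
  norm_map' := norm_mkQ_toeplitzLift

theorem symbolSection_circlePow (n m : ℕ) :
    symbolSection (circlePow ((m : ℤ) - n)) = compacts.mkQ (Tmon n m) :=
  (mkQ_Tmon n m).symm

theorem symbolSection_surjective : Function.Surjective symbolSection := by
  have hclosed : IsClosed (Set.range symbolSection) :=
    symbolSection.isometry.isUniformInducing.isComplete_range.isClosed
  have hspan : Submodule.span ℂ (Set.range fun p : ℕ × ℕ => Tmon p.1 p.2) ≤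
      symbolSection.toLinearMap.range.comap compacts.mkQ := by
    rw [Submodule.span_le]
    rintro _ ⟨p, rfl⟩
    exact ⟨_, symbolSection_circlePow p.1 p.2⟩
  intro x
  obtain ⟨A, rfl⟩ := compacts.mkQ_surjective x
  exact dense_span_Tmon.induction hspan (hclosed.preimage compacts.mkQL.continuous) A

/-- The symbol map, the isometric isomorphism `π₂` from the Toeplitz algebra modulo the compact
operators onto `C(S¹)`. -/
def symbolEquiv : (toeplitz ⧸ compacts) ≃ₗᵢ[ℂ] C(Circle, ℂ) :=
  (LinearIsometryEquiv.ofSurjective symbolSection symbolSection_surjective).symm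

theorem symbolEquiv_Tmon (n m : ℕ) :
    symbolEquiv (compacts.mkQ (Tmon n m)) = circlePow ((m : ℤ) - n) :=
  symbolEquiv.symm.injective <|
    (symbolEquiv.symm_apply_apply _).trans (symbolSection_circlePow n m).symm

/-- The symbol map on the Toeplitz algebra itself. -/
def symbol : toeplitz →L[ℂ] C(Circle, ℂ) :=
  (symbolEquiv.toContinuousLinearEquiv : (toeplitz ⧸ compacts) →L[ℂ] C(Circle, ℂ)) ∘L compacts.mkQL

theorem symbol_apply (A : toeplitz) : symbol A = symbolEquiv (compacts.mkQ A) := rfl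

theorem symbol_Tmon_mul_Tmon (n m k l : ℕ) :
    symbol (Tmon n m * Tmon k l) = symbol (Tmon n m) * symbol (Tmon k l) := by
  rw [Tmon_mul, symbol_apply, symbol_apply, symbol_apply, symbolEquiv_Tmon, symbolEquiv_Tmon,
    symbolEquiv_Tmon, circlePow_mul]
  congr 1
  omega

theorem symbol_mul (A B : toeplitz) : symbol (A * B) = symbol A * symbol B := by
  have hright (n m : ℕ) (B : toeplitz) : symbol (Tmon n m * B) = symbol (Tmon n m) * symbol B :=
    DFunLike.congr_fun (toeplitz_ext (f := symbol ∘L mul ℂ toeplitz (Tmon n m))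
      (g := mul ℂ C(Circle, ℂ) (symbol (Tmon n m)) ∘L symbol) (symbol_Tmon_mul_Tmon n m)) B
  exact DFunLike.congr_fun (toeplitz_ext (f := symbol ∘L (mul ℂ toeplitz).flip B)
    (g := (mul ℂ C(Circle, ℂ)).flip (symbol B) ∘L symbol) fun n m => hright n m B) A

theorem symbol_star (A : toeplitz) : symbol (star A) = star (symbol A) := by
  refine dense_span_Tmon.induction (P := fun A => symbol (star A) = star (symbol A))
    (fun A hA => ?_) (isClosed_eq (by fun_prop) (by fun_prop)) A
  induction hA using Submodule.span_induction with
  | mem A hA =>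
    obtain ⟨⟨n, m⟩, rfl⟩ := hA
    simp only [star_Tmon, symbol_apply, symbolEquiv_Tmon, star_circlePow, neg_sub]
  | zero => simp only [star_zero, map_zero]
  | add A B _ _ hA hB => rw [star_add, map_add, map_add, star_add, hA, hB]
  | smul c A _ hA => rw [star_smul, map_smul, map_smul, star_smul, hA]

end Symbol

section Duality

variable {E F : Type*} [NormedAddCommGroup E] [NormedSpace ℂ E] [NormedAddCommGroup F]
  [NormedSpace ℂ F]

theorem norm_comp_mkQL {S : Submodule ℂ E} (φ : StrongDual ℂ (E ⧸ S)) : ‖φ ∘L S.mkQL‖ = ‖φ‖ := by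
  apply le_antisymm
  · refine ContinuousLinearMap.opNorm_le_bound _ φ.opNorm_nonneg fun x => ?_
    exact φ.le_opNorm_of_le (Submodule.Quotient.norm_mk_le S x)
  · refine le_of_forall_gt_imp_ge_of_dense fun C hC => ?_
    have hC₀ : 0 < C := (norm_nonneg _).trans_lt hC
    refine ContinuousLinearMap.opNorm_le_bound _ hC₀.le fun x => ?_
    rw [← div_le_iff₀' hC₀]
    refine (QuotientAddGroup.le_norm_iff (S := S.toAddSubgroup)).2 fun y hy => ?_
    rw [div_le_iff₀' hC₀]
    obtain rfl : S.mkQL y = x := hy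
    exact (φ ∘L S.mkQL).le_of_opNorm_le hC.le y

/-- The isometric isomorphism of the dual of `E ⧸ S` with the annihilator of `S`, which is given as
a space `N` of functionals on `E` with the defining membership condition. -/
def dualQuotientEquiv (S : Submodule ℂ E) (N : Submodule ℂ (StrongDual ℂ E))
    (hN : ∀ ρ, ρ ∈ N ↔ ∀ x ∈ S, ρ x = 0) : StrongDual ℂ (E ⧸ S) ≃ₗᵢ[ℂ] N where
  toFun φ := ⟨φ ∘L S.mkQL, (hN _).2 fun x hx => by
    have hx₀ : S.mkQL x = 0 := (Submodule.Quotient.mk_eq_zero S).2 hx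
    rw [ContinuousLinearMap.comp_apply, hx₀, map_zero]⟩
  map_add' φ ψ := rfl
  map_smul' c φ := rfl
  invFun ρ := S.liftQL ρ.1 ((hN ρ.1).1 ρ.2)
  left_inv φ := ContinuousLinearMap.ext fun x => by
    induction x using Submodule.Quotient.induction_on
    rfl
  right_inv ρ := rfl
  norm_map' := norm_comp_mkQL

/-- The isomorphism `φ ↦ φ ∘ π` of dual spaces induced by a linear isometric isomorphism `π`. -/
def dualCongr (π : E ≃ₗᵢ[ℂ] F) : StrongDual ℂ F ≃ₗᵢ[ℂ] StrongDual ℂ E where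
  toLinearEquiv := (π.symm.toContinuousLinearEquiv.arrowCongr (.refl ℂ ℂ)).toLinearEquiv
  norm_map' φ := φ.opNorm_comp_linearIsometryEquiv π

end Duality

section Conclusion

/-- The isometric isomorphism `π₁^*` of the dual of the Toeplitz algebra modulo the compact
operators with the annihilator of the compact operators. -/
def annihilatorEquiv : StrongDual ℂ (toeplitz ⧸ compacts) ≃ₗᵢ[ℂ] annihilator :=
  dualQuotientEquiv compacts annihilator fun _ => Iff.rfl

theorem annihilatorEquiv_apply (φ : StrongDual ℂ (toeplitz ⧸ compacts)) (A : toeplitz) :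
    (annihilatorEquiv φ : StrongDual ℂ toeplitz) A = φ (compacts.mkQ A) := rfl

/-- The isomorphism of the complex measures on the circle with the dual of the Toeplitz algebra
modulo the compact operators, given by integration of the symbol. -/
def measureEquiv : ComplexMeasure Circle ≃ₗ[ℂ] StrongDual ℂ (toeplitz ⧸ compacts) :=
  rieszEquiv.trans (dualCongr symbolEquiv).toLinearEquiv

theorem measureEquiv_apply (μ : ComplexMeasure Circle) (x : toeplitz ⧸ compacts) :
    measureEquiv μ x = cintegral μ (symbolEquiv x) :=
  rieszEquiv_apply μ (symbolEquiv x)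

theorem norm_measureEquiv (μ : ComplexMeasure Circle) :
    ‖measureEquiv μ‖ = totalVariationNorm μ :=
  ((dualCongr symbolEquiv).norm_map (rieszEquiv μ)).trans (norm_rieszEquiv μ)

theorem annihilatorEquiv_measureEquiv_Tmon (μ : ComplexMeasure Circle) (n m : ℕ) :
    (annihilatorEquiv (measureEquiv μ) : StrongDual ℂ toeplitz) (Tmon n m) =
      cintegral μ (circlePow ((m : ℤ) - n)) := by
  rw [annihilatorEquiv_apply, measureEquiv_apply, symbolEquiv_Tmon]

theorem cintegral_mconv_circlePow (μ ν : ComplexMeasure Circle) (k : ℤ) :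
    cintegral (mconv μ ν) (circlePow k) =
      cintegral μ (circlePow k) * cintegral ν (circlePow k) := by
  have hm : Measurable fun p : Circle × Circle => p.1 * p.2 := by fun_prop
  have hμ : μ.Integrable (circlePow k) := integrable_continuousMap μ (circlePow k)
  have hν : ν.Integrable (circlePow k) := integrable_continuousMap ν (circlePow k)
  have hmul : (fun p : Circle × Circle => circlePow k (p.1 * p.2)) =
      fun p => circlePow k p.1 * circlePow k p.2 := funext fun p => circlePow_apply_mul k p.1 p.2
  rw [cintegral, mconv, VectorMeasure.integral_map hm
    (circlePow k).continuous.stronglyMeasurable.aestronglyMeasurable]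
  · rw [hmul]
    exact integral_prod_mul_complexMeasure hμ hν
  · change (μ.prod ν (mul ℝ ℂ)).Integrable fun p => circlePow k (p.1 * p.2)
    rw [hmul]
    exact integrable_prod_mul hμ hν

theorem elemTensor_mul (A B C D : toeplitz) :
    elemTensor (A * B) (C * D) = elemTensor A C * elemTensor B D :=
  Subtype.ext (tensorOp_mul _ _ _ _)

theorem elemTensor_star (A B : toeplitz) :
    elemTensor (star A) (star B) = star (elemTensor A B) :=
  Subtype.ext (tensorOp_star _ _).symm

theorem elemTensor_pow (A B : toeplitz) (k : ℕ) :
    elemTensor (A ^ k) (B ^ k) = elemTensor A B ^ k := by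
  induction k with
  | zero =>
    rw [pow_zero, pow_zero, pow_zero]
    exact Subtype.ext tensorOp_one
  | succ k ih => rw [pow_succ, pow_succ, elemTensor_mul, ih, pow_succ]

theorem comul_Tmon (n m : ℕ) : comul (Tmon n m) = elemTensor (Tmon n m) (Tmon n m) := by
  change comul (T ^ n * star T ^ m) = elemTensor (T ^ n * star T ^ m) (T ^ n * star T ^ m)
  rw [map_mul, map_pow, map_pow, map_star, comul_T, elemTensor_mul, elemTensor_pow, elemTensor_pow,
    elemTensor_star]

theorem dualMul_Tmon (ρ φ : StrongDual ℂ toeplitz) (n m : ℕ) :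
    dualMul ρ φ (Tmon n m) = ρ (Tmon n m) * φ (Tmon n m) := by
  rw [dualMul_apply, comul_Tmon, tensorFunctional_apply]

theorem eq_dualMul_of_Tmon {ρ φ ψ : StrongDual ℂ toeplitz}
    (h : ∀ n m, ψ (Tmon n m) = ρ (Tmon n m) * φ (Tmon n m)) : ψ = dualMul ρ φ :=
  toeplitz_ext fun n m => (h n m).trans (dualMul_Tmon ρ φ n m).symm

theorem annihilatorEquiv_measureEquiv_mconv (μ ν : ComplexMeasure Circle) :
    (annihilatorEquiv (measureEquiv (mconv μ ν)) : StrongDual ℂ toeplitz) =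
      dualMul (annihilatorEquiv (measureEquiv μ)) (annihilatorEquiv (measureEquiv ν)) :=
  eq_dualMul_of_Tmon fun n m => calc
    _ = cintegral (mconv μ ν) (circlePow ((m : ℤ) - n)) :=
        annihilatorEquiv_measureEquiv_Tmon (mconv μ ν) n m
    _ = cintegral μ (circlePow ((m : ℤ) - n)) * cintegral ν (circlePow ((m : ℤ) - n)) :=
        cintegral_mconv_circlePow μ ν _
    _ = _ := (congrArg₂ (· * ·) (annihilatorEquiv_measureEquiv_Tmon μ n m)
        (annihilatorEquiv_measureEquiv_Tmon ν n m)).symm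

theorem dualMul_mem_annihilator {ρ φ : StrongDual ℂ toeplitz} (hρ : ρ ∈ annihilator)
    (hφ : φ ∈ annihilator) : dualMul ρ φ ∈ annihilator := by
  have hsurj : Function.Surjective (annihilatorEquiv ∘ measureEquiv) :=
    annihilatorEquiv.surjective.comp measureEquiv.surjective
  obtain ⟨μ, hμ⟩ := hsurj ⟨ρ, hρ⟩
  obtain ⟨ν, hν⟩ := hsurj ⟨φ, hφ⟩
  obtain rfl : (annihilatorEquiv (measureEquiv μ)).1 = ρ := congrArg Subtype.val hμ
  obtain rfl : (annihilatorEquiv (measureEquiv ν)).1 = φ := congrArg Subtype.val hν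
  exact annihilatorEquiv_measureEquiv_mconv μ ν ▸ Subtype.mem _

end Conclusion

end ToeplitzQuantumSemigroup

end

theorem theorem9 :
    (∀ ρ ∈ annihilator, ∀ φ ∈ annihilator, dualMul ρ φ ∈ annihilator) ∧
    ∃ (π₁ : StrongDual ℂ (toeplitz ⧸ compacts) ≃ₗᵢ[ℂ] annihilator)
      (π₂ : (toeplitz ⧸ compacts) ≃ₗᵢ[ℂ] C(Circle, ℂ))
      (γ : ComplexMeasure Circle ≃ₗ[ℂ] StrongDual ℂ (toeplitz ⧸ compacts)),
      (∀ (φ : StrongDual ℂ (toeplitz ⧸ compacts)) (A : toeplitz),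
        (π₁ φ : StrongDual ℂ toeplitz) A = φ (compacts.mkQ A)) ∧
      (∀ A B : toeplitz, π₂ (compacts.mkQ (A * B)) = π₂ (compacts.mkQ A) * π₂ (compacts.mkQ B)) ∧
      (∀ A : toeplitz, π₂ (compacts.mkQ (star A)) = star (π₂ (compacts.mkQ A))) ∧
      (∀ (n m : ℕ) (z : Circle),
        π₂ (compacts.mkQ (Tmon n m)) z = (z : ℂ) ^ ((m : ℤ) - (n : ℤ))) ∧
      (∀ μ x, γ μ x = cintegral μ (π₂ x)) ∧
      (∀ μ, ‖γ μ‖ = totalVariationNorm μ) ∧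
      (∀ μ ν, (π₁ (γ (mconv μ ν)) : StrongDual ℂ toeplitz) = dualMul (π₁ (γ μ)) (π₁ (γ ν))) := by
  refine ⟨fun ρ hρ φ hφ => dualMul_mem_annihilator hρ hφ, annihilatorEquiv, symbolEquiv,
    measureEquiv, annihilatorEquiv_apply, symbol_mul, symbol_star, fun n m z => ?_,
    measureEquiv_apply, norm_measureEquiv, annihilatorEquiv_measureEquiv_mconv⟩
  rw [symbolEquiv_Tmon, circlePow_apply]
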